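/- Let $K$ be a field of characteristic zero and let $(R,\mathfrak m)$ be the local ring at $a$ of a smooth ambient variety $Z$ over $K$ (more generally, any regular local $K$-algebra). For an ideal $I\subset R$ put $H_I(k)=\operatorname{length}\,R/(I+\mathfrak m^{k+1})$, $k\in\mathbb N$; Hilbert–Samuel functions are compared pointwise. For a germ $X=V(I_X)$ at $a$ with a distinguished irreducible component $X^{(m)}$ and a reduced divisor $D=V(I_D)$ on $X$, and for $\Omega=(e,(c_1,\dots,c_n))$ and $q\in\mathbb N$, write $a\in\Sigma_{\Omega,q}$ if: exactly $n$ components $X^{(i_1)},\dots,X^{(i_n)}$ of $X$ at $a$ either equal $X^{(m)}$ or contain a component of $D$; $e$ is the embedding dimension of $\bigcup_jX^{(i_j)}$ at $a$; $c_1,\dots,c_n$ are the codimensions $e-\dim X^{(i_j)}$ (up to order); and $q$ is the minimum over $j$ of the number of components of $D$ at $a$ lying in $X^{(i_j)}$. For $|c|=c_1+\cdots+c_n$ with $|c|+q\le e$, let $H_{\Omega,q}$ be the Hilbert–Samuel function of the ideal $\bigcap_{i=1}^n(x_{i,1},\dots,x_{i,c_i},\,y_1\cdots y_q)$ in the power series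 ring over $K$ in the variables $x_{i,j}$ $(1\le i\le n,\ 1\le j\le c_i)$ and $y_1,\dots,y_{e-|c|}$. **Lemma.** Let $m\ge2$ and $\Omega=(e,(c_1,\dots,c_m))$. Suppose that $Z$ has minimal dimension $\dim R=e$, and let $\{x_{i,j}\}_{1\le i\le m,\,1\le j\le c_i},\ y_1,\dots,y_r,\ w_1,\dots,w_{e-|c|-r}$ be a regular system of parameters of $R$. Put $I_i=(x_{i,1},\dots,x_{i,c_i})$ and let $X=V(\bigcap_{i=1}^mI_i)$, with $X^{(m)}=V(I_m)$ as distinguished component. Let $D$ be a reduced divisor on $X$, with no component in $\operatorname{Sing}X$, given by an ideal of the form $$I_D=\Big[\bigcap_{i=1}^{m-1}I_i+(y_1\cdots y_r)\Big]\cap\big(I_m+(f)\big),\qquad f\in R,\tag{1}$$ and suppose that $a\in\Sigma_{\Omega,q}$. Put $H_D=H_{I_D}$ and $J=\bigcap_{i=1}^{m-1}I_i+(y_1\cdots y_r)+I_m$. Write $\operatorname{ord}g$ for the order of $g\in R$ with respect to $\mathfrak m$, and $\operatorname{ord}(g|_{X^{(m)}})\ge\operatorname{ord}g$ for the order of the class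 of $g$ in the local ring $R/I_m$. Then: 1. $H_D=H_{\Omega,q}$ if and only if $f$ can be chosen in (1) so that $\operatorname{ord}f=\operatorname{ord}(f|_{X^{(m)}})=q$, $r=q$ and $f\in J$. 2. Otherwise, $H_D\nleq H_{\Omega,q}$. 3. For any $f$ as in (1): if $\operatorname{ord}(f|_{X^{(m)}})>q$ (in particular, if $\operatorname{ord}f>q$), or $r>q$, or $f\notin J$, then $H_D\nleq H_{\Omega,q}$. -/

import Mathlib

open IsLocalRing

namespace StableSnc

section LocalRing

variable {R : Type*} [CommRing R]

/-- The Hilbert-Samuel function `H_I = H_{R/I}` of an ideal `I` of a local ring `R`: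
`H_I(k)` is the length of `(R/I) / 𝔪_{R/I}^(k+1) = R / (I + 𝔪^(k+1))`.
(The values are finite when `R` is Noetherian; `H_I = 0` for the unit ideal.)
Functions `ℕ → ℕ∞` are compared pointwise. -/
noncomputable def hilbertSamuel [IsLocalRing R] (I : Ideal R) (k : ℕ) : ℕ∞ :=
  Module.length R (R ⧸ (I ⊔ maximalIdeal R ^ (k + 1)))

/-- The order of the restriction of `f` to `V(I)`, i.e. the order of the class of `f` with respect
to the powers of the maximal ideal of `R/I`; it is `⊤` when the class is zero (`R` Noetherian). -/
noncomputable def orderOn [IsLocalRing R] (I : Ideal R) (f : R) : ℕ∞ :=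
  ⨆ (n : ℕ) (_ : f ∈ I ⊔ maximalIdeal R ^ n), (n : ℕ∞)

/-- The order of `f` in the local ring `R`: the largest `n` with `f ∈ 𝔪^n`. -/
noncomputable def order [IsLocalRing R] (f : R) : ℕ∞ :=
  orderOn ⊥ f

/-- A finite family is a regular system of coordinates (regular system of parameters) of the local
ring `R` if it generates the maximal ideal and its cardinality is the dimension of `R`. -/
structure IsRegularCoordinates [IsLocalRing R] {ι : Type*} [Fintype ι] (z : ι → R) : Prop where
  span_eq : Ideal.span (Set.range z) = maximalIdeal R
  card_eq : ringKrullDim R = (Fintype.card ι : ℕ)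

/-- The embedding dimension at the closed point of the germ `V(I)`: the minimal number of
generators of the maximal ideal of `R/I`. -/
noncomputable def embDim [IsLocalRing R] (I : Ideal R) : ℕ :=
  ((maximalIdeal R).map (Ideal.Quotient.mk I)).spanFinrank

/-- The irreducible components of `V(ID)` (minimal primes of `ID`) that lie in `V(P)`. -/
def componentsIn (ID P : Ideal R) : Set (Ideal R) :=
  {Q | Q ∈ ID.minimalPrimes ∧ P ≤ Q}

/-- `V(ID)` is (the support of) a reduced Weil divisor on `V(IX)`: a reduced subscheme of `V(IX)`
each of whose irreducible components has codimension one in every irreducible component of `V(IX)`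
that contains it. -/
structure IsReducedDivisor (IX ID : Ideal R) : Prop where
  le : IX ≤ ID
  radical : ID.IsRadical
  codim_one : ∀ Q ∈ ID.minimalPrimes, ∀ P ∈ IX.minimalPrimes, P ≤ Q →
    ringKrullDim (R ⧸ Q) + 1 = ringKrullDim (R ⧸ P)

/-- No irreducible component of `V(ID)` lies in the singular locus of `X = V(IX)`: the local ring
of `X` at the generic point of any component of `V(ID)` is regular. -/
def NoComponentInSing (IX ID : Ideal R) : Prop :=
  ∀ P : PrimeSpectrum (R ⧸ IX), P.asIdeal.comap (Ideal.Quotient.mk IX) ∈ ID.minimalPrimes →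
    IsRegularLocalRing (Localization.AtPrime P.asIdeal)

/-- The germ at `a` of the condition `a ∈ Σ_{Ω,q}(X, D)`, `Ω = (e, (c_1, …, c_n))`. Here `R` is the
local ring at `a` of an ambient variety, `IX` and `ID` are the ideals of `X` and of `Supp D`, and
`Pm` is the ideal of the distinguished ("last") component `X^{(m)}` of `X`. The components of `X`
and of `D` at `a` correspond to the minimal primes of `IX` and `ID`. The family `P` lists the
components of `X` that are equal to `X^{(m)}` or contain a component of `D`. The numbers
`c_1, …, c_n` may come in any order; putting them in decreasing order is a normalization. -/
structure InSigma [IsLocalRing R] (IX ID Pm : Ideal R) (e : ℕ) {n : ℕ} (c : Fin n → ℕ) (q : ℕ) :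
    Prop where
  mem_last : Pm ∈ IX.minimalPrimes
  exists_components : ∃ P : Fin n → Ideal R,
    Function.Injective P ∧
    Set.range P = {P' | P' ∈ IX.minimalPrimes ∧ (P' = Pm ∨ (componentsIn ID P').Nonempty)} ∧
    embDim (⨅ i, P i) = e ∧
    (∀ i, ringKrullDim (R ⧸ P i) + (c i : ℕ) = (e : ℕ)) ∧
    IsLeast (Set.range fun i => (componentsIn ID (P i)).ncard) q

/-- The ideal `I_i = (x_{i,1}, …, x_{i,c_i})`. -/
def compIdeal {n : ℕ} {c : Fin n → ℕ} (x : (i : Fin n) → Fin (c i) → R) (i : Fin n) : Ideal R :=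
  Ideal.span (Set.range (x i))

/-- With `m = p + 1`, the ideal `⋂_{i < m} I_i + (y_1 ⋯ y_r)`. -/
def firstIdeal {p r : ℕ} {c : Fin (p + 1) → ℕ} (x : (i : Fin (p + 1)) → Fin (c i) → R)
    (y : Fin r → R) : Ideal R :=
  (⨅ i : Fin p, compIdeal x i.castSucc) ⊔ Ideal.span {∏ j, y j}

end LocalRing

/-- `H_{Ω,q}`, for `Ω = (e, (c_1, …, c_n))` with `|c| + q ≤ e`: the Hilbert-Samuel function of the
ideal `⋂_i (x_{i,1}, …, x_{i,c_i}, y_1 ⋯ y_q)` in the ring of formal power series over `K` in the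
variables `x_{i,j}` (`1 ≤ j ≤ c_i`) and `y_1, …, y_{e - |c|}`. -/
noncomputable def hilbertSamuelOmega (K : Type*) [Field K] (e : ℕ) {n : ℕ} (c : Fin n → ℕ)
    (q : ℕ) : ℕ → ℕ∞ :=
  hilbertSamuel (R := MvPowerSeries ((Σ i, Fin (c i)) ⊕ Fin (e - ∑ i, c i)) K)
    (⨅ i : Fin n,
      Ideal.span (Set.range fun j : Fin (c i) => MvPowerSeries.X (Sum.inl ⟨i, j⟩)) ⊔
      Ideal.span {∏ j : Fin (e - ∑ i, c i) with j.val < q, MvPowerSeries.X (Sum.inr j)})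

end StableSnc

/-! Put `P = I_m`, let `y^γ = y_1⋯y_r` and `y^β = y_1⋯y_q`, let `A_γ = ⋂_{i<m} I_i + (y^γ)` and
define `A_β` likewise, and for fixed `N` let `L(I)` be the length of `R/(I + 𝔪^N)`. Then `I_D = A_γ
∩ (P + (f))`, while `H_{Ω,q}` is the function of `A_β ∩ (P + (y^β))`: colengths of monomial ideals
count the monomials outside them, so they agree in `R` and in the power series ring.

The Mayer–Vietoris sequence gives `L(I_D) ≥ L(A_γ) + L(P + (f)) - L(A_γ + P + (f))`, with equality
for the model because intersections of monomial ideals are compatible with truncation. Each piece is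
extremal for the model: (a) `L(P + (f)) ≥ L_N(P) - L_{N-q}(P)` when `f ∈ P + 𝔪^q`, with equality if
the order on `V(P)` is exactly `q`; (b) `L(A_γ) - L(A_γ + P) ≥ L(A_β) - L(A_β + P)` when `q ≤ r`,
strictly for some `N` if `q < r`; (c) `L(A_γ + P + (f)) ≤ L(A_γ + P)`, strictly for some `N` if `f ∉
J`. Hence `H_D ≥ H_{Ω,q}`, and the failure of any extremality condition gives a strict excess in
some degree (`exists_truncLength_model_lt`). If all three conditions hold, the two functions agree
(`truncLength_model_eq`).

The inequalities `q ≤ r` and `f ∈ P + 𝔪^q` come from counting components of `D`. Since `D` has no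
component in `Sing X`, each of its components lies in only one component of `X`
(`component_unique`). Those in `V(I_1)` are among the `V(I_1 + (y_j))`. Those in `V(P)` are
components of a hypersurface there, and their number is at most its order (`card_components_le`): a
general line gives parameters of colength at most the order, and the number of components of top
dimension is bounded by the colength of a parameter ideal.

All of this rests on the analytic independence of parameters (`IndepMod`), which uses an infinite
residue field and the height theorem. -/

namespace StableSnc

/-! ### Colength and its exact sequences. -/

section Length

variable {R : Type*} [CommRing R]

/-- The length of `R / I` as an `R`-module. -/
noncomputable def colength (I : Ideal R) : ℕ∞ := Module.length R (R ⧸ I)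

lemma hilbertSamuel_eq_colength [IsLocalRing R] (I : Ideal R) (k : ℕ) :
    hilbertSamuel I k = colength (I ⊔ maximalIdeal R ^ (k + 1)) := rfl

lemma colength_eq_add_of_le {I J : Ideal R} (h : I ≤ J) :
    colength I = Module.length R (J.map (Ideal.Quotient.mk I)) + colength J := by
  have e := DoubleQuot.quotQuotEquivQuotOfLEₐ R h
  unfold colength
  rw [← LinearEquiv.length_eq e.toLinearEquiv]
  exact Module.length_eq_add_of_exact
    (((J.map (Ideal.Quotient.mk I)).restrictScalars R).subtype)
    (((J.map (Ideal.Quotient.mk I)).restrictScalars R).mkQ)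
    (Submodule.subtype_injective _) (Submodule.mkQ_surjective _)
    (LinearMap.exact_subtype_mkQ _)

lemma colength_anti {I J : Ideal R} (h : I ≤ J) : colength J ≤ colength I := by
  rw [colength_eq_add_of_le h]
  exact le_add_self

lemma colength_add_one_le {I J : Ideal R} (h : I < J) : colength J + 1 ≤ colength I := by
  rw [colength_eq_add_of_le h.le, add_comm]
  gcongr
  rw [Order.one_le_iff_pos, Module.length_pos_iff, Submodule.nontrivial_iff_ne_bot]
  intro h0
  rw [Ideal.map_eq_bot_iff_le_ker, Ideal.mk_ker] at h0
  exact h.not_ge h0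

lemma eq_of_colength_le {I J : Ideal R} (h : I ≤ J) (hJ : colength J ≠ ⊤)
    (hle : colength I ≤ colength J) : I = J := by
  by_contra hne
  have := (colength_add_one_le (lt_of_le_of_ne h hne)).trans hle
  exact absurd this (not_le.2 (ENat.lt_add_one_iff hJ |>.2 le_rfl))

lemma colength_top : colength (⊤ : Ideal R) = 0 := by
  unfold colength
  exact Module.length_eq_zero_iff.2 (Ideal.Quotient.subsingleton_iff.2 rfl)

/-- Additivity of length on `0 → R/(I : g) → R/I → R/(I + (g)) → 0`, the first map being
multiplication by `g`. -/
lemma colength_eq_add_colon (I : Ideal R) (g : R) :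
    colength I = colength (I ⊔ Ideal.span {g}) + colength (I.colon {g}) := by
  have hexact : Function.Exact
      ((I.colon {g}).liftQ (LinearMap.toSpanSingleton R (R ⧸ I) (Ideal.Quotient.mk I g)) (by
        intro r hr
        rw [Submodule.mem_colon_singleton] at hr
        simpa [LinearMap.toSpanSingleton_apply, ← Ideal.Quotient.mk_eq_mk, ← Submodule.Quotient.mk_smul,
          Submodule.Quotient.mk_eq_zero] using hr))
      (Submodule.factor (le_sup_left : I ≤ I ⊔ Ideal.span {g})) := by
    intro a
    obtain ⟨a, rfl⟩ := Submodule.Quotient.mk_surjective _ a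
    constructor
    · intro h
      have h : (Submodule.Quotient.mk a : R ⧸ (I ⊔ Ideal.span {g})) = 0 := h
      rw [Submodule.Quotient.mk_eq_zero] at h
      obtain ⟨x, hx, y, hy, rfl⟩ := Submodule.mem_sup.1 h
      obtain ⟨t, rfl⟩ := Ideal.mem_span_singleton'.1 hy
      refine ⟨Submodule.Quotient.mk t, ?_⟩
      change (Submodule.Quotient.mk (t • g) : R ⧸ I) = _
      rw [Submodule.Quotient.eq]
      simpa using hx
    · rintro ⟨t, ht⟩
      obtain ⟨t, rfl⟩ := Submodule.Quotient.mk_surjective _ t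
      change (Submodule.Quotient.mk (t • g) : R ⧸ I) = _ at ht
      rw [← ht]
      change (Submodule.Quotient.mk (t • g) : R ⧸ (I ⊔ Ideal.span {g})) = 0
      rw [Submodule.Quotient.mk_eq_zero]
      exact Submodule.mem_sup_right (Ideal.mul_mem_left _ _ (Ideal.mem_span_singleton_self g))
  unfold colength
  rw [add_comm]
  refine Module.length_eq_add_of_exact _ _ ?_ ?_ hexact
  · rw [← LinearMap.ker_eq_bot, eq_bot_iff]
    intro t ht
    obtain ⟨t, rfl⟩ := Submodule.Quotient.mk_surjective _ t
    have ht : (Submodule.Quotient.mk (t • g) : R ⧸ I) = 0 := ht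
    rw [Submodule.Quotient.mk_eq_zero] at ht
    rw [Submodule.mem_bot, Submodule.Quotient.mk_eq_zero]
    exact Submodule.mem_colon_singleton.2 ht
  · exact Submodule.factor_surjective _

/-- The Mayer–Vietoris sequence `0 → R/(I ∩ J) → R/I × R/J → R/(I + J) → 0`. -/
lemma colength_inf_add_sup (I J : Ideal R) :
    colength (I ⊓ J) + colength (I ⊔ J) = colength I + colength J := by
  have hexact : Function.Exact
      ((Submodule.factor (inf_le_left : I ⊓ J ≤ I)).prod
        (Submodule.factor (inf_le_right : I ⊓ J ≤ J)))
      ((Submodule.factor (le_sup_left : I ≤ I ⊔ J)).coprod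
        (-(Submodule.factor (le_sup_right : J ≤ I ⊔ J)))) := by
    rintro ⟨a, b⟩
    obtain ⟨a, rfl⟩ := Submodule.Quotient.mk_surjective _ a
    obtain ⟨b, rfl⟩ := Submodule.Quotient.mk_surjective _ b
    constructor
    · intro h
      have h : (Submodule.Quotient.mk a : R ⧸ (I ⊔ J)) + -Submodule.Quotient.mk b = 0 := h
      rw [← Submodule.Quotient.mk_neg, ← Submodule.Quotient.mk_add,
        Submodule.Quotient.mk_eq_zero] at h
      obtain ⟨x, hx, y, hy, hxy⟩ := Submodule.mem_sup.1 h
      refine ⟨Submodule.Quotient.mk (a - x), Prod.ext ?_ ?_⟩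
      · change (Submodule.Quotient.mk (a - x) : R ⧸ I) = Submodule.Quotient.mk a
        rw [Submodule.Quotient.eq]
        simpa using hx
      · change (Submodule.Quotient.mk (a - x) : R ⧸ J) = Submodule.Quotient.mk b
        rw [Submodule.Quotient.eq]
        have : a - x - b = y := by linear_combination -hxy
        rwa [this]
    · rintro ⟨t, ht⟩
      rw [← ht]
      obtain ⟨t, rfl⟩ := Submodule.Quotient.mk_surjective _ t
      change (Submodule.Quotient.mk t : R ⧸ (I ⊔ J)) + -Submodule.Quotient.mk t = 0
      simp
  unfold colength
  rw [← Module.length_prod (R := R) (M := R ⧸ I)]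
  refine (Module.length_eq_add_of_exact _ _ ?_ ?_ hexact).symm
  · rw [← LinearMap.ker_eq_bot, eq_bot_iff]
    intro t ht
    obtain ⟨t, rfl⟩ := Submodule.Quotient.mk_surjective _ t
    have h1 : (Submodule.Quotient.mk t : R ⧸ I) = 0 := congrArg Prod.fst ht
    have h2 : (Submodule.Quotient.mk t : R ⧸ J) = 0 := congrArg Prod.snd ht
    rw [Submodule.Quotient.mk_eq_zero] at h1 h2
    rw [Submodule.mem_bot, Submodule.Quotient.mk_eq_zero]
    exact ⟨h1, h2⟩
  · intro t
    obtain ⟨t, rfl⟩ := Submodule.Quotient.mk_surjective _ t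
    refine ⟨(Submodule.Quotient.mk t, 0), ?_⟩
    change (Submodule.Quotient.mk t : R ⧸ (I ⊔ J)) + _ = _
    simp

/-- Filtering by powers of `g`, each successive quotient is a quotient of `R/(I + (g))`. -/
lemma colength_sup_pow_le (I : Ideal R) (g : R) (n : ℕ) :
    colength (I ⊔ Ideal.span {g ^ n}) ≤ n * colength (I ⊔ Ideal.span {g}) := by
  induction n with
  | zero => simp [Ideal.span_singleton_one, colength_top]
  | succ n ih =>
    rw [colength_eq_add_colon _ (g ^ n), Nat.cast_add, Nat.cast_one, add_mul, one_mul]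
    refine add_le_add ((colength_anti ?_).trans ih) (colength_anti ?_)
    · exact sup_le (le_sup_left.trans le_sup_left) le_sup_right
    · refine sup_le (fun x hx ↦ ?_) ?_
      · exact Submodule.mem_colon_singleton.2 (Ideal.mul_mem_right _ _ (Ideal.mem_sup_left hx))
      · rw [Ideal.span_singleton_le_iff_mem, Submodule.mem_colon_singleton, smul_eq_mul, ← pow_succ']
        exact Ideal.mem_sup_right (Ideal.mem_span_singleton_self _)

lemma colength_maximalIdeal [IsLocalRing R] : colength (maximalIdeal R) = 1 := by
  unfold colength
  rw [Module.length_eq_one_iff, isSimpleModule_iff_isCoatom]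
  exact (maximalIdeal.isMaximal R).out

end Length

/-! ### Monomial ideals and counting of monomials. -/

section Monomials

variable {R κ : Type*} [CommRing R]

/-- The monomial `∏ z_i ^ α_i`. -/
def mon (z : κ → R) (α : κ →₀ ℕ) : R := α.prod fun i n => z i ^ n

/-- The ideal generated by the monomials with exponents in `U`. -/
def monIdeal (z : κ → R) (U : Set (κ →₀ ℕ)) : Ideal R := Ideal.span (mon z '' U)

lemma mon_zero (z : κ → R) : mon z 0 = 1 := Finsupp.prod_zero_index

lemma mon_add (z : κ → R) (α β : κ →₀ ℕ) : mon z (α + β) = mon z α * mon z β := by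
  classical
  exact Finsupp.prod_add_index' (fun _ => pow_zero _) (fun _ _ _ => pow_add _ _ _)

lemma mon_single (z : κ → R) (i : κ) (n : ℕ) : mon z (Finsupp.single i n) = z i ^ n :=
  Finsupp.prod_single_index (pow_zero _)

lemma eval_eq_sum_mon (z : κ → R) (F : MvPolynomial κ R) :
    MvPolynomial.eval z F = ∑ α ∈ F.support, F.coeff α * mon z α := rfl

lemma mon_mem_monIdeal (z : κ → R) {U : Set (κ →₀ ℕ)} {α : κ →₀ ℕ} (h : α ∈ U) :
    mon z α ∈ monIdeal z U := Ideal.subset_span ⟨α, h, rfl⟩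

lemma monIdeal_mono (z : κ → R) {U V : Set (κ →₀ ℕ)} (h : U ⊆ V) :
    monIdeal z U ≤ monIdeal z V := Ideal.span_mono (Set.image_mono h)

lemma monIdeal_union (z : κ → R) (U V : Set (κ →₀ ℕ)) :
    monIdeal z (U ∪ V) = monIdeal z U ⊔ monIdeal z V := by
  rw [monIdeal, Set.image_union, Ideal.span_union]; rfl

lemma monIdeal_insert (z : κ → R) (U : Set (κ →₀ ℕ)) (α : κ →₀ ℕ) :
    monIdeal z (insert α U) = monIdeal z U ⊔ Ideal.span {mon z α} := by
  rw [monIdeal, Set.image_insert_eq, Ideal.span_insert, sup_comm]; rfl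

lemma monIdeal_univ (z : κ → R) : monIdeal z Set.univ = ⊤ :=
  (Ideal.eq_top_iff_one _).2 (mon_zero z ▸ mon_mem_monIdeal z (Set.mem_univ _))

lemma monIdeal_Ici (z : κ → R) (β : κ →₀ ℕ) :
    monIdeal z (Set.Ici β) = Ideal.span {mon z β} := by
  refine le_antisymm (Ideal.span_le.2 ?_) (Ideal.span_mono ?_)
  · rintro _ ⟨α, hα, rfl⟩
    obtain ⟨γ, rfl⟩ := exists_add_of_le (Set.mem_Ici.1 hα)
    rw [mon_add]
    exact Ideal.mul_mem_right _ _ (Ideal.mem_span_singleton_self _)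
  · rintro _ rfl
    exact ⟨β, Set.mem_Ici.2 le_rfl, rfl⟩

lemma monIdeal_exists_ne_zero (z : κ → R) (S : Set κ) :
    monIdeal z {α | ∃ i ∈ S, α i ≠ 0} = Ideal.span (z '' S) := by
  classical
  refine le_antisymm (Ideal.span_le.2 ?_) (Ideal.span_mono ?_)
  · rintro _ ⟨α, ⟨i, hi, hα⟩, rfl⟩
    have : α = Finsupp.single i 1 + (α - Finsupp.single i 1) := by
      rw [add_tsub_cancel_of_le]
      rw [Finsupp.single_le_iff]
      omega
    rw [this, mon_add, mon_single, pow_one]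
    exact Ideal.mul_mem_right _ _ (Ideal.subset_span ⟨i, hi, rfl⟩)
  · rintro _ ⟨i, hi, rfl⟩
    exact ⟨Finsupp.single i 1, ⟨i, hi, by simp⟩, by rw [mon_single, pow_one]⟩

lemma isUpperSet_exists_ne_zero (S : Set κ) :
    IsUpperSet {α : κ →₀ ℕ | ∃ i ∈ S, α i ≠ 0} := by
  rintro α β hαβ ⟨i, hi, h⟩
  exact ⟨i, hi, by have := hαβ i; omega⟩

/-- Exponents of degree at least `n`. -/
def degGE (κ : Type*) (n : ℕ) : Set (κ →₀ ℕ) := {α | n ≤ α.degree}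

@[simp] lemma mem_degGE {n : ℕ} {α : κ →₀ ℕ} : α ∈ degGE κ n ↔ n ≤ α.degree := Iff.rfl

lemma isUpperSet_degGE (n : ℕ) : IsUpperSet (degGE κ n) :=
  fun _ _ h hα => le_trans (mem_degGE.1 hα) (Finsupp.degree_mono h)

lemma mon_mem_pow (z : κ → R) (α : κ →₀ ℕ) :
    mon z α ∈ Ideal.span (Set.range z) ^ α.degree := by
  classical
  induction α using Finsupp.induction_linear with
  | zero => simp
  | add α β hα hβ =>
    rw [mon_add, map_add, pow_add]
    exact Ideal.mul_mem_mul hα hβ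
  | single i n =>
    rw [mon_single, Finsupp.degree_single]
    exact Ideal.pow_mem_pow (Ideal.subset_span (Set.mem_range_self i)) n

lemma monIdeal_degGE (z : κ → R) (n : ℕ) :
    monIdeal z (degGE κ n) = Ideal.span (Set.range z) ^ n := by
  refine le_antisymm (Ideal.span_le.2 ?_) ?_
  · rintro _ ⟨α, hα, rfl⟩
    exact Ideal.pow_le_pow_right hα (mon_mem_pow z α)
  · intro x hx
    obtain ⟨F, hF, rfl⟩ := (Ideal.mem_span_pow_iff_exists_isHomogeneous z x).1 hx
    rw [eval_eq_sum_mon]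
    refine Ideal.sum_mem _ fun α hα => Ideal.mul_mem_left _ _ (mon_mem_monIdeal z ?_)
    exact mem_degGE.2 (hF.degree_eq_sum_deg_support hα).le

variable (κ) in
/-- Exponents of degree less than `n`. -/
noncomputable def degLT [Finite κ] (n : ℕ) : Finset (κ →₀ ℕ) := (Finsupp.finite_of_degree_lt n).toFinset

@[simp] lemma mem_degLT [Finite κ] {n : ℕ} {α : κ →₀ ℕ} : α ∈ degLT κ n ↔ α.degree < n := by
  simp [degLT]

/-- Adding finitely many monomials to a monomial ideal. -/
lemma colength_sup_monIdeal_le (𝔞 : Ideal R) (z : κ → R) (s : Finset (κ →₀ ℕ))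
    (U : Set (κ →₀ ℕ)) (hU : IsUpperSet U) (hV : IsUpperSet (U ∪ s)) :
    colength (𝔞 ⊔ monIdeal z U) ≤ colength (𝔞 ⊔ monIdeal z (U ∪ s)) +
      s.card * colength (𝔞 ⊔ Ideal.span (Set.range z)) := by
  classical
  induction hn : s.card generalizing s U with
  | zero =>
    rw [Finset.card_eq_zero] at hn
    simp [hn]
  | succ n ih =>
    -- Adding a maximal exponent first keeps the set upper. Everything strictly above it is already
    -- in `U`, so `(z)` annihilates the new generator and the step costs at most one colength of `𝔞
    -- + (z)`.
    obtain ⟨α, hα⟩ := s.exists_maximal (Finset.card_pos.1 (by omega))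
    have hup : ∀ β, α < β → β ∈ U := by
      intro β hβ
      rcases hV hβ.le (Or.inr hα.1) with h | h
      · exact h
      · exact absurd (hα.2 h hβ.le) hβ.not_ge
    have hset : insert α U ∪ (s.erase α : Set (κ →₀ ℕ)) = U ∪ s := by
      ext β
      have := hα.1
      by_cases h : β = α <;> simp [h, this]
    have hU' : IsUpperSet (insert α U) := by
      rintro β γ hβγ (rfl | hβ)
      · rcases hβγ.eq_or_lt with rfl | h
        · exact Or.inl rfl
        · exact Or.inr (hup _ h)
      · exact Or.inr (hU hβγ hβ)
    have := ih (s.erase α) (insert α U) hU' (hset ▸ hV)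
      (by rw [Finset.card_erase_of_mem hα.1, hn]; rfl)
    rw [hset, monIdeal_insert, ← sup_assoc] at this
    rw [colength_eq_add_colon _ (mon z α), Nat.cast_add, Nat.cast_one, add_mul, one_mul, ← add_assoc]
    refine add_le_add this (colength_anti (sup_le (fun x hx => ?_) (Ideal.span_le.2 ?_)))
    · exact Submodule.mem_colon_singleton.2 (Ideal.mul_mem_right _ _ (Ideal.mem_sup_left hx))
    · rintro _ ⟨i, rfl⟩
      refine Submodule.mem_colon_singleton.2 (Ideal.mem_sup_right ?_)
      rw [smul_eq_mul, ← pow_one (z i), ← mon_single, ← mon_add]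
      refine mon_mem_monIdeal z (hup _ ?_)
      refine lt_of_le_of_ne le_add_self fun h => ?_
      have := DFunLike.congr_fun h i
      simp at this

variable [IsLocalRing R]

/-- A homogeneous form in the `z_i` that lies in `𝔞 + 𝔪 (z)^n` has coefficients in `𝔪`. -/
def IndepMod (𝔞 : Ideal R) (z : κ → R) : Prop :=
  ∀ (n : ℕ) (F : MvPolynomial κ R), F.IsHomogeneous n →
    MvPolynomial.eval z F ∈ 𝔞 ⊔ maximalIdeal R * Ideal.span (Set.range z) ^ n →
    ∀ α, F.coeff α ∈ maximalIdeal R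

/-- Modulo `𝔪 (z)^|α|` only the monomials of `U` of degree `|α|` survive, so membership would
produce a form in `𝔞 + 𝔪 (z)^|α|` with coefficient `1` at `α`. -/
lemma IndepMod.mon_notMem {𝔞 : Ideal R} {z : κ → R} (h : IndepMod 𝔞 z)
    (hz : ∀ i, z i ∈ maximalIdeal R) {α : κ →₀ ℕ} {U : Set (κ →₀ ℕ)} (hU : U ⊆ degGE κ α.degree)
    (hα : α ∉ U) : mon z α ∉ 𝔞 ⊔ monIdeal z U := by
  classical
  intro hmem
  have key : ∀ x ∈ monIdeal z U, ∃ F : MvPolynomial κ R, F.IsHomogeneous α.degree ∧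
      F.coeff α = 0 ∧ x - MvPolynomial.eval z F ∈
        maximalIdeal R * Ideal.span (Set.range z) ^ α.degree := by
    intro x hx
    induction hx using Submodule.span_induction with
    | mem x hx =>
      obtain ⟨β, hβ, rfl⟩ := hx
      rcases (mem_degGE.1 (hU hβ)).eq_or_lt with he | hlt
      · refine ⟨MvPolynomial.monomial β 1, MvPolynomial.isHomogeneous_monomial _ he.symm, ?_, ?_⟩
        · rw [MvPolynomial.coeff_monomial, if_neg]
          rintro rfl
          exact hα hβ
        · rw [MvPolynomial.eval_monomial, one_mul, mon, sub_self]
          exact zero_mem _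
      · refine ⟨0, MvPolynomial.isHomogeneous_zero _ _ _, by simp, ?_⟩
        rw [map_zero, sub_zero]
        refine Ideal.mul_mono_left (?_ : Ideal.span (Set.range z) ≤ _) ?_
        · exact Ideal.span_le.2 (by rintro _ ⟨i, rfl⟩; exact hz i)
        · rw [← pow_succ']
          exact Ideal.pow_le_pow_right hlt (mon_mem_pow z β)
    | zero => exact ⟨0, MvPolynomial.isHomogeneous_zero _ _ _, by simp, by simp⟩
    | add x y _ _ hx hy =>
      obtain ⟨F, hF, hF0, hx⟩ := hx
      obtain ⟨G, hG, hG0, hy⟩ := hy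
      refine ⟨F + G, hF.add hG, by simp [hF0, hG0], ?_⟩
      rw [map_add, add_sub_add_comm]
      exact add_mem hx hy
    | smul r x _ hx =>
      obtain ⟨F, hF, hF0, hx⟩ := hx
      refine ⟨MvPolynomial.C r * F, ?_, by simp [hF0], ?_⟩
      · simpa using (MvPolynomial.isHomogeneous_C κ r).mul hF
      · rw [map_mul, MvPolynomial.eval_C, smul_eq_mul, ← mul_sub]
        exact Ideal.mul_mem_left _ _ hx
  obtain ⟨a, ha, x, hx, hax⟩ := Submodule.mem_sup.1 hmem
  obtain ⟨F, hF, hF0, hxF⟩ := key x hx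
  have := h α.degree (MvPolynomial.monomial α 1 - F)
    ((MvPolynomial.isHomogeneous_monomial _ rfl).sub hF) (by
      rw [map_sub, MvPolynomial.eval_monomial, one_mul]
      change mon z α - _ ∈ _
      rw [← hax, add_sub_assoc]
      exact Submodule.add_mem_sup ha hxF) α
  rw [MvPolynomial.coeff_sub, hF0, MvPolynomial.coeff_monomial, if_pos rfl, sub_zero] at this
  exact (Ideal.ne_top_iff_one _).1 (maximalIdeal.isMaximal R).ne_top this

variable [Finite κ]

/-- The lower bound for the Hilbert-Samuel function of an analytically independent family. -/
lemma IndepMod.card_degLT_le {𝔞 : Ideal R} {z : κ → R} (h : IndepMod 𝔞 z)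
    (hz : ∀ i, z i ∈ maximalIdeal R) (n : ℕ) :
    ((degLT κ n).card : ℕ∞) ≤ colength (𝔞 ⊔ Ideal.span (Set.range z) ^ n) := by
  classical
  induction n with
  | zero =>
    have : degLT κ 0 = ∅ := by ext; simp
    simp [this]
  | succ n ih =>
    -- Deleting the monomials of degree `n` one at a time, each deletion strictly shrinks the ideal
    -- by independence.
    have layer : ∀ s : Finset (κ →₀ ℕ), (∀ α ∈ s, α.degree = n) →
        colength (𝔞 ⊔ Ideal.span (Set.range z) ^ n) + s.card ≤
          colength (𝔞 ⊔ monIdeal z (degGE κ n \ s)) := by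
      intro s
      induction s using Finset.induction_on with
      | empty => intro _; simp [monIdeal_degGE]
      | insert α s hα hs =>
        intro hdeg
        have hα' := hdeg α (Finset.mem_insert_self _ _)
        refine le_trans ?_ (colength_add_one_le (I := 𝔞 ⊔ monIdeal z (degGE κ n \ ↑(insert α s)))
          (J := 𝔞 ⊔ monIdeal z (degGE κ n \ ↑s)) ?_)
        · rw [Finset.card_insert_of_notMem hα, Nat.cast_add, Nat.cast_one, ← add_assoc]
          exact add_le_add_left (hs fun β hβ => hdeg β (Finset.mem_insert_of_mem hβ)) 1
        · refine lt_of_le_of_ne (sup_le_sup_left (monIdeal_mono z (Set.sdiff_subset_sdiff_right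
            (Finset.coe_subset.2 (Finset.subset_insert α s)))) _) fun heq => ?_
          refine h.mon_notMem hz (α := α) (U := degGE κ n \ ↑(insert α s)) ?_ ?_ ?_
          · rw [hα']; exact Set.sdiff_subset
          · simp
          · rw [heq]
            exact Ideal.mem_sup_right (mon_mem_monIdeal z (Set.mem_sdiff _ |>.2 ⟨mem_degGE.2 hα'.ge, hα⟩))
    have h1 := layer ((degLT κ (n + 1)).filter fun α => α.degree = n) (by simp)
    have h2 : degGE κ n \ ((degLT κ (n + 1)).filter fun α => α.degree = n) = degGE κ (n + 1) := by
      ext α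
      simp only [mem_degGE, Set.mem_sdiff, Finset.mem_coe, Finset.mem_filter, mem_degLT]
      omega
    rw [h2, monIdeal_degGE] at h1
    refine le_trans ?_ h1
    have h3 : degLT κ (n + 1) = degLT κ n ∪ (degLT κ (n + 1)).filter fun α => α.degree = n := by
      ext α
      simp only [Finset.mem_union, Finset.mem_filter, mem_degLT]
      omega
    calc ((degLT κ (n + 1)).card : ℕ∞) ≤ ((degLT κ n).card + _ : ℕ) := by
          rw [h3]
          exact Nat.cast_le.2 (Finset.card_union_le _ _)
      _ ≤ _ := by
          rw [Nat.cast_add]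
          exact add_le_add ih le_rfl

/-- The colength of a monomial ideal is the number of monomials outside of it. -/
lemma IndepMod.colength_monIdeal {z : κ → R} (h : IndepMod ⊥ z)
    (hz : Ideal.span (Set.range z) = maximalIdeal R) {U : Set (κ →₀ ℕ)} (hU : IsUpperSet U)
    (s : Finset (κ →₀ ℕ)) (hs : ∀ α, α ∈ s ↔ α ∉ U) : colength (monIdeal z U) = s.card := by
  classical
  have hzm : ∀ i, z i ∈ maximalIdeal R := fun i => hz ▸ Ideal.subset_span ⟨i, rfl⟩
  have hUs : U ∪ s = Set.univ := by
    ext α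
    simp [hs, em]
  have up := colength_sup_monIdeal_le ⊥ z s U hU (hUs ▸ isUpperSet_univ)
  rw [hUs, monIdeal_univ, hz, bot_sup_eq, bot_sup_eq, bot_sup_eq, colength_top,
    colength_maximalIdeal, zero_add, mul_one] at up
  refine le_antisymm up ?_
  obtain ⟨n, hn⟩ : ∃ n, s ⊆ degLT κ n := by
    refine ⟨s.sup Finsupp.degree + 1, fun α hα => ?_⟩
    rw [mem_degLT, Nat.lt_succ_iff]
    exact Finset.le_sup (f := Finsupp.degree) hα
  have hset : degGE κ n ∪ ↑(degLT κ n \ s) = U := by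
    ext α
    have := @hn α
    simp only [mem_degGE, Set.mem_union, Finset.coe_sdiff, Set.mem_sdiff,
      Finset.mem_coe, mem_degLT, hs, not_not] at this ⊢
    by_cases hα : α ∈ U
    · simp only [hα, and_true, iff_true]; omega
    · simp only [hα, and_false, or_false, iff_false, not_le]; exact this hα
  -- For the lower bound, pass from the monomials of degree at least `n` to all of `U`: this lowers
  -- the colength by at most the number of added monomials, and the initial colength is at least the
  -- number of monomials of degree below `n`.
  have rel := colength_sup_monIdeal_le ⊥ z (degLT κ n \ s) (degGE κ n) (isUpperSet_degGE n)
    (hset ▸ hU)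
  have low := h.card_degLT_le hzm n
  rw [hset, monIdeal_degGE, hz, bot_sup_eq, bot_sup_eq, bot_sup_eq, colength_maximalIdeal,
    mul_one] at rel
  rw [hz, bot_sup_eq] at low
  have := low.trans rel
  rw [← Finset.card_sdiff_add_card_eq_card hn, Nat.cast_add, add_comm] at this
  exact (ENat.add_le_add_iff_right (ENat.natCast_ne_top _)).1 this

/-- Inclusion–exclusion for the complements matches Mayer–Vietoris for the ideals, so the obvious
inclusion is between ideals of equal finite colength. -/
lemma IndepMod.monIdeal_inf_of_finite {z : κ → R} (h : IndepMod ⊥ z)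
    (hz : Ideal.span (Set.range z) = maximalIdeal R) {U V : Set (κ →₀ ℕ)} (hU : IsUpperSet U)
    (hV : IsUpperSet V) (s t : Finset (κ →₀ ℕ)) (hs : ∀ α, α ∈ s ↔ α ∉ U)
    (ht : ∀ α, α ∈ t ↔ α ∉ V) : monIdeal z U ⊓ monIdeal z V = monIdeal z (U ∩ V) := by
  classical
  have hle : monIdeal z (U ∩ V) ≤ monIdeal z U ⊓ monIdeal z V :=
    le_inf (monIdeal_mono z Set.inter_subset_left) (monIdeal_mono z Set.inter_subset_right)
  have e1 := h.colength_monIdeal hz hU s hs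
  have e2 := h.colength_monIdeal hz hV t ht
  have e3 := h.colength_monIdeal hz (hU.inter hV) (s ∪ t) (by
    intro α; simp only [Finset.mem_union, hs, ht, Set.mem_inter_iff]; tauto)
  have e4 := h.colength_monIdeal hz (hU.union hV) (s ∩ t) (by
    intro α; simp only [Finset.mem_inter, hs, ht, Set.mem_union]; tauto)
  have e5 := colength_inf_add_sup (monIdeal z U) (monIdeal z V)
  rw [← monIdeal_union, e1, e2, e4, ← Nat.cast_add, ← Finset.card_union_add_card_inter,
    Nat.cast_add] at e5
  have e6 := WithTop.add_right_cancel (ENat.natCast_ne_top _) e5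
  exact (eq_of_colength_le hle (by rw [e6]; exact ENat.natCast_ne_top _) (by rw [e6, e3])).symm

/-- Krull's intersection theorem in `R/I`. -/
lemma le_of_forall_le_sup_pow [IsNoetherianRing R] {I J : Ideal R}
    (h : ∀ n, J ≤ I ⊔ maximalIdeal R ^ n) : J ≤ I := by
  intro x hx
  have := Ideal.iInf_pow_smul_eq_bot_of_isLocalRing (R := R) (M := R ⧸ I) (maximalIdeal R)
    (maximalIdeal.isMaximal R).ne_top
  rw [← Ideal.Quotient.eq_zero_iff_mem, ← Submodule.mem_bot R, ← this, Submodule.mem_iInf]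
  intro n
  obtain ⟨a, ha, b, hb, rfl⟩ := Submodule.mem_sup.1 (h n hx)
  rw [map_add, Ideal.Quotient.eq_zero_iff_mem.2 ha, zero_add]
  have : (Ideal.Quotient.mk I b) = b • (1 : R ⧸ I) := by
    rw [Algebra.smul_def, mul_one]; rfl
  rw [this]
  exact Submodule.smul_mem_smul hb trivial

lemma IndepMod.monIdeal_inf [IsNoetherianRing R] {z : κ → R} (h : IndepMod ⊥ z)
    (hz : Ideal.span (Set.range z) = maximalIdeal R) {U V : Set (κ →₀ ℕ)} (hU : IsUpperSet U)
    (hV : IsUpperSet V) : monIdeal z U ⊓ monIdeal z V = monIdeal z (U ∩ V) := by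
  classical
  refine le_antisymm (le_of_forall_le_sup_pow fun n => ?_)
    (le_inf (monIdeal_mono z Set.inter_subset_left) (monIdeal_mono z Set.inter_subset_right))
  -- Adding all monomials of degree at least `n` makes the complements finite; Krull's theorem
  -- removes them again.
  rw [← hz, ← monIdeal_degGE, ← monIdeal_union, Set.inter_union_distrib_right,
    ← h.monIdeal_inf_of_finite hz (hU.union (isUpperSet_degGE n)) (hV.union (isUpperSet_degGE n))
      ((degLT κ n).filter (· ∉ U)) ((degLT κ n).filter (· ∉ V))]
  · exact inf_le_inf (monIdeal_mono z Set.subset_union_left) (monIdeal_mono z Set.subset_union_left)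
  · intro α
    simp [degGE, and_comm]
  · intro α
    simp [degGE, and_comm]

lemma IndepMod.monIdeal_iInf [IsNoetherianRing R] {z : κ → R} (h : IndepMod ⊥ z)
    (hz : Ideal.span (Set.range z) = maximalIdeal R) {τ : Type*} [Finite τ]
    {U : τ → Set (κ →₀ ℕ)} (hU : ∀ i, IsUpperSet (U i)) :
    ⨅ i, monIdeal z (U i) = monIdeal z (⋂ i, U i) := by
  classical
  have := Fintype.ofFinite τ
  have key : ∀ s : Finset τ, ⨅ i ∈ s, monIdeal z (U i) = monIdeal z (⋂ i ∈ s, U i) := by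
    intro s
    induction s using Finset.induction_on with
    | empty => simp [monIdeal_univ]
    | insert i s _ ih =>
      rw [Finset.iInf_insert, ih, h.monIdeal_inf hz (hU i)
        (isUpperSet_iInter₂ fun j _ => hU j), Finset.set_biInter_insert]
  simpa using key Finset.univ

end Monomials

/-! ### Analytic independence of parameters and orders of products. -/

section Independence

variable {R κ : Type*} [CommRing R]

lemma sup_pow_le_sup (I J : Ideal R) (n : ℕ) : (I ⊔ J) ^ n ≤ I ⊔ J ^ n := by
  induction n with
  | zero => simp
  | succ n ih =>
    calc (I ⊔ J) ^ (n + 1) = (I ⊔ J) ^ n * (I ⊔ J) := pow_succ _ _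
      _ ≤ (I ⊔ J ^ n) * (I ⊔ J) := Ideal.mul_mono_left ih
      _ = I * (I ⊔ J) ⊔ (J ^ n * I ⊔ J ^ n * J) := by rw [Ideal.sup_mul, Ideal.mul_sup (J ^ n)]
      _ ≤ I ⊔ (I ⊔ J ^ (n + 1)) :=
        sup_le_sup Ideal.mul_le_left (sup_le_sup Ideal.mul_le_right (pow_succ J n).ge)
      _ = I ⊔ J ^ (n + 1) := by rw [← sup_assoc, sup_idem]

lemma eval_mul_const {F : MvPolynomial κ R} {n : ℕ} (hF : F.IsHomogeneous n) (b : κ → R) (t : R) :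
    MvPolynomial.eval (fun i => b i * t) F = MvPolynomial.eval b F * t ^ n := by
  rw [MvPolynomial.eval_eq, MvPolynomial.eval_eq, Finset.sum_mul]
  refine Finset.sum_congr rfl fun d hd => ?_
  simp only [mul_pow]
  rw [Finset.prod_mul_distrib, Finset.prod_pow_eq_pow_sum,
    ← hF.degree_eq_sum_deg_support hd, mul_assoc]

lemma eval_sub_eval_mem {I : Ideal R} {a b : κ → R} (h : ∀ i, a i - b i ∈ I)
    (F : MvPolynomial κ R) : MvPolynomial.eval a F - MvPolynomial.eval b F ∈ I := by
  rw [← Ideal.Quotient.mk_eq_mk_iff_sub_mem]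
  change Ideal.Quotient.mk I (MvPolynomial.eval₂ _ _ _) =
    Ideal.Quotient.mk I (MvPolynomial.eval₂ _ _ _)
  rw [MvPolynomial.eval₂_comp_left, MvPolynomial.eval₂_comp_left]
  congr 1
  ext i
  exact (Ideal.Quotient.mk_eq_mk_iff_sub_mem _ _).2 (h i)

lemma eval_mem_mul_pow {I : Ideal R} {F : MvPolynomial κ R} {n : ℕ} (hF : F.IsHomogeneous n)
    (z : κ → R) (h : ∀ α, F.coeff α ∈ I) :
    MvPolynomial.eval z F ∈ I * Ideal.span (Set.range z) ^ n := by
  rw [eval_eq_sum_mon]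
  refine Ideal.sum_mem _ fun α hα => Ideal.mul_mem_mul (h α) ?_
  have : n = α.degree := hF.degree_eq_sum_deg_support hα
  exact this ▸ mon_mem_pow z α

variable [IsLocalRing R]

lemma map_residue_eq_zero_iff (F : MvPolynomial κ R) :
    MvPolynomial.map (residue R) F = 0 ↔ ∀ α, F.coeff α ∈ maximalIdeal R := by
  rw [MvPolynomial.ext_iff]
  simp [MvPolynomial.coeff_map, residue_eq_zero_iff]

/-- The ideal of a line through the origin of the `z`-space, given by a direction `b`. -/
def lineIdeal (z b : κ → R) (j : κ) : Ideal R :=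
  Ideal.span (Set.range fun i : {i // i ≠ j} => z i - b i * z j)

/-- A form that is nonzero modulo `𝔪` does not vanish identically along some line. -/
lemma exists_line [Infinite (ResidueField R)] {F : MvPolynomial κ R} {n : ℕ}
    (hF : F.IsHomogeneous n) (hn : n ≠ 0) (hF0 : ¬ ∀ α, F.coeff α ∈ maximalIdeal R) (z : κ → R) :
    ∃ (j : κ) (b : κ → R) (u : R), IsUnit u ∧ Ideal.span (Set.range z) ≤
      lineIdeal z b j ⊔ Ideal.span {z j} ∧ MvPolynomial.eval z F - u * z j ^ n ∈ lineIdeal z b j := by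
  classical
  rw [← map_residue_eq_zero_iff] at hF0
  have hF' := hF.map (residue R)
  set G := MvPolynomial.map (residue R) F with hG
  -- A nonzero polynomial over the infinite residue field has a nonvanishing point; since `n ≠ 0`
  -- that point is not the origin, and scaling makes its `j`-th coordinate `1`.
  obtain ⟨a, ha⟩ : ∃ a, MvPolynomial.eval a G ≠ 0 := by
    by_contra! h
    exact hF0 (MvPolynomial.funext fun x => by rw [h x, map_zero])
  obtain ⟨j, hj⟩ : ∃ j, a j ≠ 0 := by
    by_contra! h
    apply ha
    have h1 := eval_mul_const hF' a 0
    rw [zero_pow hn, mul_zero] at h1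
    rw [← h1]
    congr 2
    ext i
    simp [h i]
  obtain ⟨b', hb'⟩ : ∃ b' : κ → R, ∀ i, residue R (b' i) = a i * (a j)⁻¹ :=
    ⟨fun i => (residue_surjective (a i * (a j)⁻¹)).choose,
      fun i => (residue_surjective (a i * (a j)⁻¹)).choose_spec⟩
  set b := Function.update b' j 1 with hbdef
  have hbj : b j = 1 := Function.update_self ..
  have hb : ∀ i, residue R (b i) = a i * (a j)⁻¹ := by
    intro i
    by_cases h : i = j
    · subst h; rw [hbj, map_one, mul_inv_cancel₀ hj]
    · rw [hbdef, Function.update_of_ne h, hb']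
  have hu : residue R (MvPolynomial.eval b F) ≠ 0 := by
    have : residue R (MvPolynomial.eval b F) = MvPolynomial.eval (fun i => a i * (a j)⁻¹) G := by
      rw [hG, MvPolynomial.eval_map, MvPolynomial.eval, MvPolynomial.coe_eval₂Hom,
        MvPolynomial.eval₂_comp_left]
      congr 1
      ext i
      exact hb i
    rw [this, eval_mul_const hF']
    exact mul_ne_zero ha (pow_ne_zero _ (inv_ne_zero hj))
  have hmem : ∀ i, z i - b i * z j ∈ lineIdeal z b j := by
    intro i
    by_cases h : i = j
    · subst h; simp [hbj]
    · exact Ideal.subset_span (Set.mem_range_self (⟨i, h⟩ : {i // i ≠ j}))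
  refine ⟨j, b, MvPolynomial.eval b F, (residue_ne_zero_iff_isUnit _).1 hu, Ideal.span_le.2 ?_, ?_⟩
  · rintro _ ⟨i, rfl⟩
    rw [SetLike.mem_coe, ← sub_add_cancel (z i) (b i * z j)]
    exact Submodule.add_mem_sup (hmem i)
      (Ideal.mul_mem_left _ _ (Ideal.mem_span_singleton_self _))
  · rw [← eval_mul_const hF]
    exact eval_sub_eval_mem hmem F

lemma lineIdeal_le {z : κ → R} (hz : ∀ i, z i ∈ maximalIdeal R) (b : κ → R) (j : κ) :
    lineIdeal z b j ≤ maximalIdeal R := by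
  refine Ideal.span_le.2 ?_
  rintro _ ⟨i, rfl⟩
  exact sub_mem (hz i) (Ideal.mul_mem_left _ _ (hz j))

/-- Krull's height theorem in `R/𝔞`: the maximal ideal is minimal over the images of `s`. -/
lemma ringKrullDim_quotient_le [IsNoetherianRing R] (𝔞 : Ideal R) {s : Set R} (hs : s.Finite)
    (hsm : s ⊆ maximalIdeal R) (h : maximalIdeal R ≤ (𝔞 ⊔ Ideal.span s).radical) :
    ringKrullDim (R ⧸ 𝔞) ≤ (s.ncard : ℕ) := by
  by_cases htop : 𝔞 = ⊤
  · have : Subsingleton (R ⧸ 𝔞) := Ideal.Quotient.subsingleton_iff.2 htop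
    rw [ringKrullDim_eq_bot_of_subsingleton]
    exact bot_le
  have : Nontrivial (R ⧸ 𝔞) := Ideal.Quotient.nontrivial_iff.2 htop
  have : IsLocalRing (R ⧸ 𝔞) := .of_surjective' _ Ideal.Quotient.mk_surjective
  have hcomap : (maximalIdeal (R ⧸ 𝔞)).comap (Ideal.Quotient.mk 𝔞) = maximalIdeal R :=
    ((local_hom_TFAE (Ideal.Quotient.mk 𝔞)).out 0 4).1
      (IsLocalHom.of_surjective _ Ideal.Quotient.mk_surjective)
  have hmin : maximalIdeal (R ⧸ 𝔞) ∈ (Ideal.span (Ideal.Quotient.mk 𝔞 '' s)).minimalPrimes := by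
    refine ⟨⟨(maximalIdeal.isMaximal _).isPrime, ?_⟩, ?_⟩
    · rw [Ideal.span_le]
      rintro _ ⟨x, hx, rfl⟩
      have : x ∈ (maximalIdeal (R ⧸ 𝔞)).comap (Ideal.Quotient.mk 𝔞) := hcomap ▸ hsm hx
      exact this
    · rintro P ⟨hP, hle⟩ _
      have h2 : maximalIdeal R ≤ P.comap (Ideal.Quotient.mk 𝔞) := by
        refine h.trans ((Ideal.IsPrime.radical_le_iff (hP.comap _)).2 (sup_le ?_ ?_))
        · intro x hx
          rw [Ideal.mem_comap, Ideal.Quotient.eq_zero_iff_mem.2 hx]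
          exact zero_mem _
        · rw [Ideal.span_le]
          intro x hx
          exact hle (Ideal.subset_span ⟨x, hx, rfl⟩)
      rw [← Ideal.map_comap_of_surjective _ Ideal.Quotient.mk_surjective
        (maximalIdeal (R ⧸ 𝔞)), hcomap]
      exact Ideal.map_le_iff_le_comap.2 h2
  rw [← IsLocalRing.maximalIdeal_height_eq_ringKrullDim]
  have h1 := Ideal.height_le_card_of_mem_minimalPrimes_span (hs.image _) hmin
  have h2 : (Ideal.Quotient.mk 𝔞 '' s).ncard ≤ s.ncard := Set.ncard_image_le hs
  have h3 : (maximalIdeal (R ⧸ 𝔞)).height ≤ ((s.ncard : ℕ) : ℕ∞) := h1.trans (Nat.cast_le.2 h2)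
  exact_mod_cast h3

/-- Parameters modulo `𝔞` are analytically independent modulo `𝔞`. -/
lemma indepMod_of_card_le_ringKrullDim [IsNoetherianRing R] [Infinite (ResidueField R)] [Finite κ]
    {𝔞 : Ideal R} {z : κ → R} (hz : ∀ i, z i ∈ maximalIdeal R)
    (hrad : maximalIdeal R ≤ (𝔞 ⊔ Ideal.span (Set.range z)).radical)
    (hdim : (Nat.card κ : ℕ) ≤ ringKrullDim (R ⧸ 𝔞)) : IndepMod 𝔞 z := by
  classical
  intro n F hF hmem
  by_contra hcoef
  have hspan : Ideal.span (Set.range z) ≤ maximalIdeal R :=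
    Ideal.span_le.2 (by rintro _ ⟨i, rfl⟩; exact hz i)
  have h𝔞 : 𝔞 ≤ maximalIdeal R := by
    refine le_maximalIdeal fun h => ?_
    have : Subsingleton (R ⧸ 𝔞) := Ideal.Quotient.subsingleton_iff.2 h
    rw [ringKrullDim_eq_bot_of_subsingleton] at hdim
    simp at hdim
  rcases eq_or_ne n 0 with rfl | hn
  · have hFC := MvPolynomial.totalDegree_eq_zero_iff_eq_C.1
      (Nat.le_zero.1 hF.totalDegree_le)
    rw [pow_zero, mul_one, hFC, MvPolynomial.eval_C, sup_eq_right.2 h𝔞] at hmem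
    refine hcoef fun α => ?_
    rw [hFC, MvPolynomial.coeff_C]
    split_ifs
    · exact hmem
    · exact zero_mem _
  -- On the line, the form is a unit times `z_j^n`, yet it lies in `𝔪 z_j^n` modulo `𝔞 + L`. So
  -- `z_j^n ∈ 𝔞 + L`, and the generators of `L`, fewer than `Nat.card κ`, would cut `V(𝔞)` down to
  -- the closed point.
  · obtain ⟨j, b, u, hu, hle, hFu⟩ := exists_line hF hn hcoef z
    set L := lineIdeal z b j with hL
    have h1 : maximalIdeal R * Ideal.span (Set.range z) ^ n ≤
        L ⊔ maximalIdeal R * Ideal.span {z j ^ n} := by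
      refine (Ideal.mul_mono_right ((Ideal.pow_right_mono hle n).trans (sup_pow_le_sup _ _ _))).trans ?_
      rw [Ideal.mul_sup, Ideal.span_singleton_pow]
      exact sup_le_sup_right Ideal.mul_le_right _
    have h2 : u * z j ^ n ∈ (𝔞 ⊔ L) ⊔ maximalIdeal R * Ideal.span {z j ^ n} := by
      have : u * z j ^ n = MvPolynomial.eval z F - (MvPolynomial.eval z F - u * z j ^ n) := by ring
      rw [this, sup_assoc]
      refine sub_mem (sup_le_sup_left h1 _ hmem) (Ideal.mem_sup_right (Ideal.mem_sup_left hFu))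
    obtain ⟨x, hx, y, hy, hxy⟩ := Submodule.mem_sup.1 h2
    obtain ⟨μ, hμ, rfl⟩ := Ideal.mem_mul_span_singleton.1 hy
    have hunit : IsUnit (u - μ) := by
      by_contra hc
      exact (mem_maximalIdeal u).1 (by
        rw [← sub_add_cancel u μ]; exact add_mem ((mem_maximalIdeal _).2 hc) hμ) hu
    have h3 : z j ^ n ∈ 𝔞 ⊔ L := by
      have : (u - μ) * z j ^ n ∈ 𝔞 ⊔ L := by
        have : (u - μ) * z j ^ n = x := by linear_combination -hxy
        rwa [this]
      exact (Ideal.unit_mul_mem_iff_mem _ hunit).1 this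
    have h4 : maximalIdeal R ≤ (𝔞 ⊔ L).radical := by
      refine hrad.trans (Ideal.radical_le_radical_iff.2 (sup_le (le_sup_left.trans Ideal.le_radical)
        (hle.trans (sup_le (le_sup_right.trans Ideal.le_radical) ?_))))
      rw [Ideal.span_singleton_le_iff_mem]
      exact ⟨n, h3⟩
    have h5 := ringKrullDim_quotient_le 𝔞 (Set.finite_range _)
      (Ideal.span_le.1 (lineIdeal_le hz b j)) h4
    have h6 : (Set.range fun i : {i // i ≠ j} => z i - b i * z j).ncard < Nat.card κ := by
      have := Fintype.ofFinite κ
      rw [← Set.image_univ]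
      refine (Set.ncard_image_le Set.finite_univ).trans_lt ?_
      rw [Set.ncard_univ, Nat.card_eq_fintype_card, Nat.card_eq_fintype_card]
      exact Fintype.card_subtype_lt (x := j) (by simp)
    have h7 := hdim.trans h5
    rw [Nat.cast_le] at h7
    omega

lemma sup_pow_le_sup_span_pow {𝔞 : Ideal R} {z : κ → R}
    (hz : 𝔞 ⊔ Ideal.span (Set.range z) = maximalIdeal R) (n : ℕ) :
    𝔞 ⊔ maximalIdeal R ^ n ≤ 𝔞 ⊔ Ideal.span (Set.range z) ^ n :=
  sup_le le_sup_left (by rw [← hz]; exact sup_pow_le_sup _ _ _)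

lemma exists_leadingForm {𝔞 : Ideal R} {z : κ → R}
    (hz : 𝔞 ⊔ Ideal.span (Set.range z) = maximalIdeal R) {a : R} {i : ℕ}
    (ha : a ∈ 𝔞 ⊔ maximalIdeal R ^ i) (ha' : a ∉ 𝔞 ⊔ maximalIdeal R ^ (i + 1)) :
    ∃ F : MvPolynomial κ R, F.IsHomogeneous i ∧ a - MvPolynomial.eval z F ∈ 𝔞 ∧
      ¬ ∀ α, F.coeff α ∈ maximalIdeal R := by
  obtain ⟨x, hx, y, hy, rfl⟩ := Submodule.mem_sup.1 (sup_pow_le_sup_span_pow hz i ha)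
  obtain ⟨F, hF, rfl⟩ := (Ideal.mem_span_pow_iff_exists_isHomogeneous z y).1 hy
  refine ⟨F, hF, by simpa using hx, fun h0 => ha' (Submodule.add_mem_sup hx ?_)⟩
  rw [pow_succ']
  exact Ideal.mul_mono_right (Ideal.pow_right_mono (hz ▸ le_sup_right) i) (eval_mem_mul_pow hF z h0)

/-- The graded ring of `R/𝔞` is a polynomial ring over the residue field, hence a domain: the
product of two nonzero leading forms is nonzero. -/
lemma IndepMod.mul_notMem {𝔞 : Ideal R} {z : κ → R} (h : IndepMod 𝔞 z)
    (hz : 𝔞 ⊔ Ideal.span (Set.range z) = maximalIdeal R) {a b : R} {i j : ℕ}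
    (ha : a ∈ 𝔞 ⊔ maximalIdeal R ^ i) (ha' : a ∉ 𝔞 ⊔ maximalIdeal R ^ (i + 1))
    (hb : b ∈ 𝔞 ⊔ maximalIdeal R ^ j) (hb' : b ∉ 𝔞 ⊔ maximalIdeal R ^ (j + 1)) :
    a * b ∉ 𝔞 ⊔ maximalIdeal R ^ (i + j + 1) := by
  have hzm : Ideal.span (Set.range z) ≤ maximalIdeal R := hz ▸ le_sup_right
  obtain ⟨F, hF, haF, hF0⟩ := exists_leadingForm hz ha ha'
  obtain ⟨G, hG, hbG, hG0⟩ := exists_leadingForm hz hb hb'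
  rw [← map_residue_eq_zero_iff] at hF0 hG0
  intro hab
  have h1 : MvPolynomial.eval z (F * G) ∈
      𝔞 ⊔ maximalIdeal R * Ideal.span (Set.range z) ^ (i + j) := by
    have e : MvPolynomial.eval z (F * G) = a * b - ((a - MvPolynomial.eval z F) * b +
        (b - MvPolynomial.eval z G) * MvPolynomial.eval z F) := by
      rw [map_mul]; ring
    rw [e]
    refine sub_mem ?_ (Ideal.mem_sup_left
      (add_mem (Ideal.mul_mem_right _ _ haF) (Ideal.mul_mem_right _ _ hbG)))
    have e2 : 𝔞 ⊔ Ideal.span (Set.range z) ^ (i + j + 1) ≤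
        𝔞 ⊔ maximalIdeal R * Ideal.span (Set.range z) ^ (i + j) := by
      rw [pow_succ']
      exact sup_le_sup_left (Ideal.mul_mono_left hzm) _
    exact e2 (sup_pow_le_sup_span_pow hz _ hab)
  have h2 := (map_residue_eq_zero_iff _).2 (h _ _ (hF.mul hG) h1)
  rw [map_mul] at h2
  exact (mul_eq_zero.1 h2).elim hF0 hG0

lemma exists_mem_sup_pow_notMem [IsNoetherianRing R] {𝔞 : Ideal R} {a : R} (ha : a ∉ 𝔞) :
    ∃ i, a ∈ 𝔞 ⊔ maximalIdeal R ^ i ∧ a ∉ 𝔞 ⊔ maximalIdeal R ^ (i + 1) := by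
  classical
  have hex : ∃ n, a ∉ 𝔞 ⊔ maximalIdeal R ^ n := by
    by_contra! h
    exact ha (le_of_forall_le_sup_pow (J := Ideal.span {a})
      (fun n => (Ideal.span_singleton_le_iff_mem _).2 (h n)) (Ideal.mem_span_singleton_self a))
  obtain ⟨n, hn⟩ : ∃ n, Nat.find hex = n + 1 := by
    refine Nat.exists_eq_succ_of_ne_zero fun h0 => ?_
    have := Nat.find_spec hex
    rw [h0, pow_zero, Ideal.one_eq_top, sup_top_eq] at this
    exact this trivial
  refine ⟨n, ?_, hn ▸ Nat.find_spec hex⟩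
  exact not_not.1 (Nat.find_min hex (by omega))

/-- Orders are finite outside `𝔞` and add under multiplication, so `R/𝔞` is a domain. -/
lemma IndepMod.isPrime [IsNoetherianRing R] {𝔞 : Ideal R} {z : κ → R} (h : IndepMod 𝔞 z)
    (hz : 𝔞 ⊔ Ideal.span (Set.range z) = maximalIdeal R) : 𝔞.IsPrime := by
  refine ⟨fun htop => ?_, fun {a b} hab => ?_⟩
  · rw [htop, top_sup_eq] at hz
    exact (maximalIdeal.isMaximal R).ne_top hz.symm
  · by_contra! hc
    obtain ⟨i, hi, hi'⟩ := exists_mem_sup_pow_notMem hc.1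
    obtain ⟨j, hj, hj'⟩ := exists_mem_sup_pow_notMem hc.2
    exact h.mul_notMem hz hi hi' hj hj' (Ideal.mem_sup_left hab)

lemma pow_mem_colon {𝔞 : Ideal R} {f : R} {q : ℕ} (hf : f ∈ 𝔞 ⊔ maximalIdeal R ^ q) (N : ℕ) :
    𝔞 ⊔ maximalIdeal R ^ (N - q) ≤ (𝔞 ⊔ maximalIdeal R ^ N).colon {f} := by
  intro x hx
  rw [Submodule.mem_colon_singleton, smul_eq_mul]
  obtain ⟨a, ha, b, hb, rfl⟩ := Submodule.mem_sup.1 hx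
  obtain ⟨c, hc, d, hd, rfl⟩ := Submodule.mem_sup.1 hf
  have e : (a + b) * (c + d) = (a * (c + d) + b * c) + b * d := by ring
  rw [e]
  refine Submodule.add_mem_sup
    (add_mem (Ideal.mul_mem_right _ _ ha) (Ideal.mul_mem_left _ _ hc)) ?_
  have h1 := Ideal.mul_mem_mul hb hd
  rw [← pow_add] at h1
  exact Ideal.pow_le_pow_right (by omega) h1

lemma colength_le_add_of_mem {𝔞 : Ideal R} {f : R} {q : ℕ} (hf : f ∈ 𝔞 ⊔ maximalIdeal R ^ q)
    (N : ℕ) : colength (𝔞 ⊔ maximalIdeal R ^ N) ≤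
      colength (𝔞 ⊔ Ideal.span {f} ⊔ maximalIdeal R ^ N) +
        colength (𝔞 ⊔ maximalIdeal R ^ (N - q)) := by
  rw [colength_eq_add_colon _ f, sup_right_comm 𝔞]
  exact add_le_add le_rfl (colength_anti (pow_mem_colon hf N))

/-- Since orders add, `(𝔞 + 𝔪^N) : f` is exactly `𝔞 + 𝔪^(N - q)`. For `N ≤ q` the truncated
subtraction gives the unit ideal, as it should. -/
lemma IndepMod.colength_eq_add {𝔞 : Ideal R} {z : κ → R} (h : IndepMod 𝔞 z)
    (hz : 𝔞 ⊔ Ideal.span (Set.range z) = maximalIdeal R) {f : R} {q : ℕ}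
    (hf : f ∈ 𝔞 ⊔ maximalIdeal R ^ q) (hf' : f ∉ 𝔞 ⊔ maximalIdeal R ^ (q + 1)) (N : ℕ) :
    colength (𝔞 ⊔ maximalIdeal R ^ N) =
      colength (𝔞 ⊔ Ideal.span {f} ⊔ maximalIdeal R ^ N) +
        colength (𝔞 ⊔ maximalIdeal R ^ (N - q)) := by
  classical
  have : (𝔞 ⊔ maximalIdeal R ^ N).colon {f} = 𝔞 ⊔ maximalIdeal R ^ (N - q) := by
    refine le_antisymm (fun g hg => ?_) (pow_mem_colon hf N)
    rw [Submodule.mem_colon_singleton, smul_eq_mul] at hg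
    by_contra hgN
    have hex : ∃ n, g ∉ 𝔞 ⊔ maximalIdeal R ^ n := ⟨_, hgN⟩
    obtain ⟨n, hn⟩ : ∃ n, Nat.find hex = n + 1 := by
      refine Nat.exists_eq_succ_of_ne_zero fun h0 => ?_
      have := Nat.find_spec hex
      rw [h0, pow_zero, Ideal.one_eq_top, sup_top_eq] at this
      exact this trivial
    have h1 : g ∈ 𝔞 ⊔ maximalIdeal R ^ n := not_not.1 (Nat.find_min hex (by omega))
    have h2 : g ∉ 𝔞 ⊔ maximalIdeal R ^ (n + 1) := hn ▸ Nat.find_spec hex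
    have h3 : n + 1 ≤ N - q := hn ▸ Nat.find_le hgN
    have h4 : 𝔞 ⊔ maximalIdeal R ^ N ≤ 𝔞 ⊔ maximalIdeal R ^ (n + q + 1) :=
      sup_le_sup_left (Ideal.pow_le_pow_right (by omega)) _
    exact h.mul_notMem hz h1 h2 hf hf' (h4 hg)
  rw [colength_eq_add_colon _ f, sup_right_comm 𝔞, this]

end Independence

/-! ### Number of top-dimensional components versus colength of a parameter ideal. -/

section PrimeCount

variable {R κ : Type*} [CommRing R]

/-- Artin–Rees for the submodule of `R/P` generated by `g`, followed by cancelling `g`, a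
nonzerodivisor modulo `P`. -/
lemma exists_colon_sup_pow_le [IsNoetherianRing R] {P : Ideal R} (hP : P.IsPrime) (𝔮 : Ideal R)
    {g : R} (hg : g ∉ P) : ∃ c, ∀ k, (P ⊔ 𝔮 ^ (k + c)).colon {g} ≤ P ⊔ 𝔮 ^ k := by
  obtain ⟨c, hc⟩ := Ideal.exists_pow_inf_eq_pow_smul (M := R ⧸ P) 𝔮
    (Submodule.span R {Ideal.Quotient.mk P g})
  refine ⟨c, fun k x hx => ?_⟩
  rw [Submodule.mem_colon_singleton, smul_eq_mul] at hx
  have h1 : Ideal.Quotient.mk P (x * g) ∈ (𝔮 ^ (k + c) • ⊤ : Submodule R (R ⧸ P)) ⊓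
      Submodule.span R {Ideal.Quotient.mk P g} := by
    refine ⟨?_, Submodule.mem_span_singleton.2 ⟨x, rfl⟩⟩
    obtain ⟨a, ha, b, hb, hab⟩ := Submodule.mem_sup.1 hx
    rw [← hab, map_add, Ideal.Quotient.eq_zero_iff_mem.2 ha, zero_add]
    have : Ideal.Quotient.mk P b = b • (1 : R ⧸ P) := by rw [Algebra.smul_def, mul_one]; rfl
    rw [this]
    exact Submodule.smul_mem_smul hb trivial
  rw [hc _ (Nat.le_add_left c k), Nat.add_sub_cancel] at h1
  have h2 := (Submodule.smul_mono le_rfl inf_le_right :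
    𝔮 ^ k • (𝔮 ^ c • ⊤ ⊓ Submodule.span R {Ideal.Quotient.mk P g}) ≤
      𝔮 ^ k • Submodule.span R {Ideal.Quotient.mk P g}) h1
  obtain ⟨y, hy, hyx⟩ := Submodule.mem_smul_span_singleton.1 h2
  have h3 : (x - y) * g ∈ P := by
    rw [sub_mul, ← Ideal.Quotient.mk_eq_mk_iff_sub_mem, ← hyx]
    rfl
  have h4 := (hP.mem_or_mem h3).resolve_right hg
  rw [← sub_add_cancel x y]
  exact Submodule.add_mem_sup h4 hy

lemma exists_sum_colength_le [IsNoetherianRing R] (𝔮 : Ideal R) (s : Finset (Ideal R))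
    (hprime : ∀ P ∈ s, P.IsPrime) (hanti : ∀ P ∈ s, ∀ Q ∈ s, P ≤ Q → P = Q) :
    ∃ c, ∀ k, ∑ P ∈ s, colength (P ⊔ 𝔮 ^ k) ≤ colength (s.inf id ⊔ 𝔮 ^ (k + c)) := by
  classical
  induction s using Finset.induction_on with
  | empty => exact ⟨0, by simp⟩
  | insert P s hPs ih =>
    obtain ⟨c, hc⟩ := ih (fun Q hQ => hprime Q (Finset.mem_insert_of_mem hQ))
      (fun Q hQ Q' hQ' => hanti Q (Finset.mem_insert_of_mem hQ) Q' (Finset.mem_insert_of_mem hQ'))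
    have hP := hprime P (Finset.mem_insert_self _ _)
    have hnot : ¬ s.inf id ≤ P := by
      rw [hP.inf_le']
      rintro ⟨Q, hQ, hle⟩
      have := hanti Q (Finset.mem_insert_of_mem hQ) P (Finset.mem_insert_self _ _) hle
      exact hPs (this ▸ hQ)
    -- An element of all the other primes but not of `P` separates `P`: adding `g` leaves the other
    -- primes to the induction, and the colon by `g` sees only `P`.
    obtain ⟨g, hg, hgP⟩ := SetLike.not_le_iff_exists.1 hnot
    obtain ⟨c', hc'⟩ := exists_colon_sup_pow_le hP 𝔮 hgP
    refine ⟨c + c', fun k => ?_⟩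
    rw [Finset.sum_insert hPs, Finset.inf_insert, id, add_comm (colength _),
      colength_eq_add_colon (P ⊓ s.inf id ⊔ 𝔮 ^ (k + (c + c'))) g]
    refine add_le_add ((hc k).trans (colength_anti ?_)) (colength_anti ?_)
    · refine sup_le (sup_le (inf_le_right.trans le_sup_left) ?_) ?_
      · exact le_sup_of_le_right (Ideal.pow_le_pow_right (by omega))
      · exact (Ideal.span_singleton_le_iff_mem _).2 (Ideal.mem_sup_left hg)
    · have e : P ⊓ s.inf id ⊔ 𝔮 ^ (k + (c + c')) ≤ P ⊔ 𝔮 ^ (k + c + c') := by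
        rw [← add_assoc]
        exact sup_le_sup_right inf_le_left _
      have e' : P ⊔ 𝔮 ^ (k + c) ≤ P ⊔ 𝔮 ^ k :=
        sup_le_sup_left (Ideal.pow_le_pow_right (Nat.le_add_right k c)) _
      exact (Submodule.colon_mono e le_rfl).trans ((hc' (k + c)).trans e')

lemma card_degLT_le_pow [Finite κ] (n : ℕ) : (degLT κ n).card ≤ n ^ Nat.card κ := by
  classical
  have := Fintype.ofFinite κ
  calc (degLT κ n).card ≤ (Finset.univ : Finset (κ → Fin n)).card := by
        refine Finset.card_le_card_of_surjOn
          (fun φ => Finsupp.equivFunOnFinite.symm fun i => (φ i : ℕ)) fun α hα => ?_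
        rw [Finset.mem_coe, mem_degLT] at hα
        refine ⟨fun i => ⟨α i, (Finsupp.le_degree i α).trans_lt hα⟩, by simp, ?_⟩
        ext i
        simp
    _ = n ^ Nat.card κ := by simp [Nat.card_eq_fintype_card]

lemma le_of_forall_mul_card_degLT_le [Finite κ] {t ν c : ℕ}
    (h : ∀ k, t * (degLT κ k).card ≤ (degLT κ (k + c)).card * ν) : t ≤ ν := by
  by_contra! hlt
  -- If `ν < t`, iterating the hypothesis from `k = 1` in steps of `c` makes the number of monomials
  -- grow at least like `((ν + 1)/ν)^j`, whereas it is bounded by a polynomial in `j`.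
  have hiter : ∀ j, (ν + 1) ^ j ≤ ν ^ j * (1 + j * c) ^ Nat.card κ := by
    intro j
    refine le_trans ?_ (Nat.mul_le_mul_left _ (card_degLT_le_pow (κ := κ) _))
    induction j with
    | zero =>
      have : 0 < (degLT κ 1).card := Finset.card_pos.2 ⟨0, by simp⟩
      simpa using this
    | succ j ih =>
      calc (ν + 1) ^ (j + 1) ≤ (ν ^ j * (degLT κ (1 + j * c)).card) * (ν + 1) := by
            rw [pow_succ]; gcongr
        _ = ν ^ j * ((ν + 1) * (degLT κ (1 + j * c)).card) := by ring
        _ ≤ ν ^ j * ((degLT κ (1 + j * c + c)).card * ν) := by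
            exact Nat.mul_le_mul_left _ ((Nat.mul_le_mul_right _ hlt).trans (h _))
        _ = ν ^ (j + 1) * (degLT κ (1 + (j + 1) * c)).card := by
            rw [show 1 + (j + 1) * c = 1 + j * c + c by ring]; ring
  rcases Nat.eq_zero_or_pos ν with rfl | hν
  · simpa using hiter 1
  have hν' : (0 : ℝ) < ν := by exact_mod_cast hν
  have hr : (1 : ℝ) < (ν + 1) / ν := by rw [lt_div_iff₀ hν']; linarith
  have hlim := tendsto_pow_const_div_const_pow_of_one_lt (Nat.card κ) hr
  have hpos : (0 : ℝ) < 1 / (1 + c) ^ Nat.card κ := by positivity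
  obtain ⟨j, hj, hj1⟩ := ((hlim.eventually (gt_mem_nhds hpos)).and
    (Filter.eventually_ge_atTop 1)).exists
  have h1 : ((ν : ℝ) + 1) ^ j ≤ ν ^ j * (1 + j * c) ^ Nat.card κ := by exact_mod_cast hiter j
  have h2 : ((1 : ℝ) + j * c) ^ Nat.card κ ≤ (j : ℝ) ^ Nat.card κ * (1 + c) ^ Nat.card κ := by
    rw [← mul_pow]
    have : (1 : ℝ) ≤ j := by exact_mod_cast hj1
    gcongr
    nlinarith
  rw [div_pow, div_lt_div_iff₀ (by positivity) (by positivity), one_mul,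
    lt_div_iff₀ (by positivity)] at hj
  have h3 : (ν : ℝ) ^ j * (1 + j * c) ^ Nat.card κ ≤
      ν ^ j * ((j : ℝ) ^ Nat.card κ * (1 + c) ^ Nat.card κ) := by gcongr
  linarith

/-- The number of components of maximal dimension is at most the colength of a parameter ideal. -/
theorem card_le_of_colength_le [IsLocalRing R] [IsNoetherianRing R] [Infinite (ResidueField R)]
    [Finite κ] {𝔞 : Ideal R} {z : κ → R} (hz : ∀ i, z i ∈ maximalIdeal R)
    (hrad : maximalIdeal R ≤ (𝔞 ⊔ Ideal.span (Set.range z)).radical) {ν : ℕ}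
    (hν : colength (𝔞 ⊔ Ideal.span (Set.range z)) ≤ ν) (s : Finset (Ideal R))
    (hprime : ∀ P ∈ s, P.IsPrime) (h𝔞 : ∀ P ∈ s, 𝔞 ≤ P)
    (hanti : ∀ P ∈ s, ∀ Q ∈ s, P ≤ Q → P = Q)
    (hdim : ∀ P ∈ s, (Nat.card κ : ℕ) ≤ ringKrullDim (R ⧸ P)) : s.card ≤ ν := by
  obtain ⟨c, hc⟩ := exists_sum_colength_le (Ideal.span (Set.range z)) s hprime hanti
  refine le_of_forall_mul_card_degLT_le (κ := κ) (c := c) fun k => ?_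
  have h1 : ∀ P ∈ s, ((degLT κ k).card : ℕ∞) ≤ colength (P ⊔ Ideal.span (Set.range z) ^ k) :=
    fun P hP => (indepMod_of_card_le_ringKrullDim hz (hrad.trans
      (Ideal.radical_mono (sup_le_sup_right (h𝔞 P hP) _))) (hdim P hP)).card_degLT_le hz k
  have h2 := colength_sup_monIdeal_le 𝔞 z (degLT κ (k + c)) (degGE κ (k + c))
    (isUpperSet_degGE _) (by
      have : degGE κ (k + c) ∪ ↑(degLT κ (k + c)) = Set.univ := by
        ext α
        simp only [Set.mem_union, mem_degGE, Finset.mem_coe, mem_degLT, Set.mem_univ, iff_true]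
        omega
      rw [this]; exact isUpperSet_univ)
  have h3 : degGE κ (k + c) ∪ ↑(degLT κ (k + c)) = Set.univ := by
    ext α
    simp only [Set.mem_union, mem_degGE, Finset.mem_coe, mem_degLT, Set.mem_univ, iff_true]
    omega
  rw [h3, monIdeal_univ, sup_top_eq, colength_top, zero_add, monIdeal_degGE] at h2
  -- Each prime contributes at least the number of monomials of degree below `k`, by independence
  -- modulo that prime; the total is at most `ν` times the number of degree below `k + c`.
  have h4 : ((s.card * (degLT κ k).card : ℕ) : ℕ∞) ≤ ((degLT κ (k + c)).card * ν : ℕ) := by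
    calc ((s.card * (degLT κ k).card : ℕ) : ℕ∞) = ∑ P ∈ s, ((degLT κ k).card : ℕ∞) := by
          simp
      _ ≤ ∑ P ∈ s, colength (P ⊔ Ideal.span (Set.range z) ^ k) := Finset.sum_le_sum h1
      _ ≤ colength (𝔞 ⊔ Ideal.span (Set.range z) ^ (k + c)) :=
          (hc k).trans (colength_anti (sup_le_sup_right (Finset.le_inf h𝔞) _))
      _ ≤ _ := h2.trans (by rw [Nat.cast_mul]; gcongr)
  exact_mod_cast h4

end PrimeCount

/-! ### The variables of a power series ring as independent generators. -/

section PowerSeries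

variable {σ K : Type*} [Field K]

lemma mon_X (α : σ →₀ ℕ) :
    mon (MvPowerSeries.X : σ → MvPowerSeries σ K) α = MvPowerSeries.monomial α 1 := by
  rw [MvPowerSeries.monomial_one_eq]; rfl

lemma mem_maximalIdeal_mvPowerSeries {f : MvPowerSeries σ K} :
    f ∈ maximalIdeal (MvPowerSeries σ K) ↔ MvPowerSeries.constantCoeff f = 0 := by
  rw [mem_maximalIdeal, mem_nonunits_iff, MvPowerSeries.isUnit_iff_constantCoeff,
    isUnit_iff_ne_zero, not_not]

lemma coeff_eq_zero_of_mem_pow {f : MvPowerSeries σ K} {n : ℕ}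
    (hf : f ∈ Ideal.span (Set.range (MvPowerSeries.X : σ → MvPowerSeries σ K)) ^ n)
    {α : σ →₀ ℕ} (hα : α.degree < n) : MvPowerSeries.coeff α f = 0 := by
  classical
  rw [← monIdeal_degGE] at hf
  induction hf using Submodule.span_induction generalizing α with
  | mem x hx =>
    obtain ⟨β, hβ, rfl⟩ := hx
    rw [mon_X, MvPowerSeries.coeff_monomial, if_neg]
    rintro rfl
    exact absurd (mem_degGE.1 hβ) (by omega)
  | zero => simp
  | add x y _ _ hx hy => rw [map_add, hx hα, hy hα, add_zero]
  | smul r x _ hx =>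
    rw [smul_eq_mul, MvPowerSeries.coeff_mul]
    refine Finset.sum_eq_zero fun p hp => ?_
    rw [hx, mul_zero]
    refine (Finsupp.degree_mono ?_).trans_lt hα
    rw [← Finset.HasAntidiagonal.mem_antidiagonal.1 hp]
    exact le_add_self

variable [Finite σ]

lemma span_range_X_eq_maximalIdeal :
    Ideal.span (Set.range (MvPowerSeries.X : σ → MvPowerSeries σ K)) = maximalIdeal _ := by
  classical
  have := Fintype.ofFinite σ
  refine le_antisymm (Ideal.span_le.2 ?_) fun f hf => ?_
  · rintro _ ⟨i, rfl⟩
    exact mem_maximalIdeal_mvPowerSeries.2 (MvPowerSeries.constantCoeff_X i)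
  · rw [mem_maximalIdeal_mvPowerSeries] at hf
    -- Choosing for each nonzero exponent one variable that divides it splits `f` into finitely many
    -- series, the `i`-th divisible by `X i`.
    have hpick : ∀ α : σ →₀ ℕ, ∃ i : Option σ, (α ≠ 0 → ∃ j, i = some j ∧ α j ≠ 0) := by
      intro α
      by_cases h : α = 0
      · exact ⟨none, fun h' => absurd h h'⟩
      · obtain ⟨j, hj⟩ := Finsupp.ne_iff.1 h
        exact ⟨some j, fun _ => ⟨j, rfl, hj⟩⟩
    choose pick hpick using hpick
    let g : σ → MvPowerSeries σ K := fun i α =>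
      if α ≠ 0 ∧ pick α = some i then MvPowerSeries.coeff α f else 0
    have hg : ∀ i α, MvPowerSeries.coeff α (g i) =
      if α ≠ 0 ∧ pick α = some i then MvPowerSeries.coeff α f else 0 := fun _ _ => rfl
    have hsum : f = ∑ i, g i := by
      ext α
      rw [map_sum]
      simp only [hg]
      by_cases hα : α = 0
      · subst hα
        simpa using hf
      · obtain ⟨j, hj, -⟩ := hpick α hα
        simp [hα, hj]
    rw [hsum]
    refine Ideal.sum_mem _ fun i _ => ?_
    have : (MvPowerSeries.X i : MvPowerSeries σ K) ∣ g i := by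
      rw [MvPowerSeries.X_dvd_iff]
      intro α hα
      rw [hg, if_neg]
      rintro ⟨h0, h1⟩
      obtain ⟨j, hj, hj'⟩ := hpick α h0
      rw [h1, Option.some.injEq] at hj
      exact hj' (hj ▸ hα)
    obtain ⟨t, ht⟩ := this
    rw [ht]
    exact Ideal.mul_mem_right _ _ (Ideal.subset_span (Set.mem_range_self i))

lemma indepMod_X : IndepMod ⊥ (MvPowerSeries.X : σ → MvPowerSeries σ K) := by
  classical
  intro n F hF hmem α
  rw [bot_sup_eq, ← span_range_X_eq_maximalIdeal, ← pow_succ'] at hmem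
  rw [mem_maximalIdeal_mvPowerSeries]
  by_cases hα : α.degree = n
  · have h1 := coeff_eq_zero_of_mem_pow hmem (α := α) (by omega)
    rw [eval_eq_sum_mon, map_sum, Finset.sum_eq_single α] at h1
    · rw [mon_X, MvPowerSeries.coeff_mul_monomial, if_pos le_rfl, tsub_self, mul_one] at h1
      exact h1
    · intro β hβ hne
      rw [mon_X, MvPowerSeries.coeff_mul_monomial, if_neg]
      intro hle
      have h2 : n = β.degree := hF.degree_eq_sum_deg_support hβ
      obtain ⟨γ, rfl⟩ := exists_add_of_le hle
      rw [map_add] at hα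
      have h3 : γ.degree = 0 := by omega
      rw [Finsupp.degree_eq_zero_iff] at h3
      exact hne (by rw [h3, add_zero])
    · intro h
      rw [MvPolynomial.notMem_support_iff.1 h, zero_mul, map_zero]
  · rw [hF.coeff_eq_zero hα, map_zero]

end PowerSeries

/-! ### Regular coordinates: coordinate primes and components of hypersurfaces. -/

section Coordinates

variable {R ι : Type*} [CommRing R] [IsLocalRing R]

lemma IndepMod.mon_notMem_monIdeal [Finite ι] {z : ι → R} (h : IndepMod ⊥ z)
    (hz : Ideal.span (Set.range z) = maximalIdeal R) {U : Set (ι →₀ ℕ)} (hU : IsUpperSet U)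
    {α : ι →₀ ℕ} (hα : α ∉ U) {N : ℕ} (hN : α.degree < N) :
    mon z α ∉ monIdeal z U ⊔ maximalIdeal R ^ N := by
  classical
  intro hmem
  rw [← hz, ← monIdeal_degGE, ← monIdeal_union] at hmem
  have hV := hU.union (isUpperSet_degGE (κ := ι) N)
  have e1 := h.colength_monIdeal hz hV ((degLT ι N).filter (· ∉ U)) (by simp [and_comm])
  have e2 := h.colength_monIdeal hz (hV.union (isUpperSet_Ici α))
    ((degLT ι N).filter fun γ => γ ∉ U ∧ ¬ α ≤ γ) (by intro γ; simp; tauto)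
  -- Membership would mean that adding `mon z α` changes nothing, yet the count of outside monomials
  -- loses `α`.
  rw [monIdeal_union, monIdeal_Ici,
    sup_eq_left.2 ((Ideal.span_singleton_le_iff_mem _).2 hmem), e1, Nat.cast_inj] at e2
  refine absurd e2 (Finset.card_lt_card ?_).ne'
  refine (Finset.ssubset_iff_of_subset fun γ hγ => ?_).2 ⟨α, ?_, ?_⟩
  · simp only [Finset.mem_filter] at hγ ⊢
    tauto
  · simp [hα, hN]
  · simp

lemma natCast_le_of_add_le {a b : ℕ} {D : WithBot ℕ∞}
    (h : ((a + b : ℕ) : WithBot ℕ∞) ≤ D + (b : ℕ)) : (a : ℕ) ≤ D := by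
  induction D using WithBot.recBotCoe with
  | bot =>
    rw [WithBot.bot_add, le_bot_iff] at h
    exact absurd h WithBot.coe_ne_bot
  | coe d =>
    have h5 : ((a : ℕ∞) + b) ≤ d + b := by exact_mod_cast h
    have h6 := (ENat.add_le_add_iff_right (ENat.natCast_ne_top _)).1 h5
    exact_mod_cast h6

lemma span_image_sup_span_compl {z : ι → R}
    (hz : Ideal.span (Set.range z) = maximalIdeal R) (S : Set ι) :
    Ideal.span (z '' S) ⊔ Ideal.span (Set.range fun i : {i // i ∉ S} => z i) =
      maximalIdeal R := by
  rw [← hz, ← Ideal.span_union]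
  congr 1
  ext x
  constructor
  · rintro (⟨i, -, rfl⟩ | ⟨i, rfl⟩) <;> exact Set.mem_range_self _
  · rintro ⟨i, rfl⟩
    by_cases h : i ∈ S
    · exact Or.inl ⟨i, h, rfl⟩
    · exact Or.inr ⟨⟨i, h⟩, rfl⟩

variable [Fintype ι] [IsNoetherianRing R]

lemma IsRegularCoordinates.card_le_ringKrullDim {z : ι → R} (hz : IsRegularCoordinates z)
    (S : Set ι) : (Nat.card {i // i ∉ S} : ℕ) ≤ ringKrullDim (R ⧸ Ideal.span (z '' S)) := by
  classical
  have h1 := ringKrullDim_le_ringKrullDim_quotient_add_encard (z '' S) (by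
    rintro _ ⟨i, -, rfl⟩
    rw [SetLike.mem_coe, ringJacobson_eq_maximalIdeal]
    exact (hz.span_eq ▸ Ideal.subset_span (Set.mem_range_self i)))
  have h2 : (z '' S).encard ≤ (S.ncard : ℕ∞) := by
    rw [Set.Finite.cast_ncard_eq S.toFinite]
    exact Set.encard_image_le z S
  have h3 : Fintype.card ι = Nat.card {i // i ∉ S} + S.ncard := by
    rw [← Nat.card_eq_fintype_card, ← Set.ncard_add_ncard_compl S, add_comm]
    rfl
  rw [hz.card_eq, h3] at h1
  have h4 : ((Nat.card {i // i ∉ S} + S.ncard : ℕ) : WithBot ℕ∞) ≤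
      ringKrullDim (R ⧸ Ideal.span (z '' S)) + ((S.ncard : ℕ) : WithBot ℕ∞) :=
    h1.trans (add_le_add le_rfl (by exact_mod_cast h2))
  exact natCast_le_of_add_le h4

variable [Infinite (ResidueField R)]

lemma IsRegularCoordinates.indepMod {z : ι → R} (hz : IsRegularCoordinates z) (S : Set ι) :
    IndepMod (Ideal.span (z '' S)) (fun i : {i // i ∉ S} => z i) := by
  refine indepMod_of_card_le_ringKrullDim (fun i => ?_) ?_ (hz.card_le_ringKrullDim S)
  · exact hz.span_eq ▸ Ideal.subset_span (Set.mem_range_self _)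
  · rw [span_image_sup_span_compl hz.span_eq]
    exact Ideal.le_radical

lemma IsRegularCoordinates.indepMod_bot {z : ι → R} (hz : IsRegularCoordinates z) :
    IndepMod ⊥ z := by
  refine indepMod_of_card_le_ringKrullDim (fun i => ?_) ?_ ?_
  · exact hz.span_eq ▸ Ideal.subset_span (Set.mem_range_self _)
  · rw [bot_sup_eq, hz.span_eq]
    exact Ideal.le_radical
  · rw [ringKrullDim_eq_of_ringEquiv (RingEquiv.quotientBot R), hz.card_eq,
      Nat.card_eq_fintype_card]

lemma IsRegularCoordinates.isPrime {z : ι → R} (hz : IsRegularCoordinates z) (S : Set ι) :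
    (Ideal.span (z '' S)).IsPrime :=
  (hz.indepMod S).isPrime (span_image_sup_span_compl hz.span_eq S)

/-- Minimal generators of the maximal ideal are regular coordinates, and the coordinate ideal of the
empty set of indices is the zero ideal. -/
lemma isDomain_of_isRegularLocalRing (A : Type*) [CommRing A] [IsRegularLocalRing A]
    [Infinite (ResidueField A)] : IsDomain A := by
  obtain ⟨z, hz⟩ : ∃ z : Fin (maximalIdeal A).spanFinrank → A,
      Ideal.span (Set.range z) = maximalIdeal A := by
    have hfg : (maximalIdeal A).FG := IsNoetherian.noetherian _
    have hcard := Submodule.FG.generators_ncard hfg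
    have hfin := Submodule.FG.finite_generators hfg
    have := hfin.to_subtype
    let e : Fin (maximalIdeal A).spanFinrank ≃ (maximalIdeal A).generators :=
      (Finite.equivFinOfCardEq hcard).symm
    refine ⟨fun i => e i, ?_⟩
    have : Set.range (fun i => (e i : A)) = (maximalIdeal A).generators := by
      rw [show (fun i => (e i : A)) = Subtype.val ∘ e from rfl, Set.range_comp, e.range_eq_univ,
        Set.image_univ, Subtype.range_coe]
    rw [this]
    exact (maximalIdeal A).span_generators
  have hreg : IsRegularCoordinates z :=
    ⟨hz, by rw [Fintype.card_fin]; exact IsRegularLocalRing.spanFinrank_maximalIdeal.symm⟩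
  have := hreg.isPrime ∅
  rw [Set.image_empty, Ideal.span_empty] at this
  exact IsDomain.of_bot_isPrime A

/-- The number of components of a hypersurface in `V(z_i, i ∈ S)` is at most its order. -/
lemma IsRegularCoordinates.card_components_le {z : ι → R} (hz : IsRegularCoordinates z)
    (S : Set ι) {f : R} {ν : ℕ} (hf : f ∈ Ideal.span (z '' S) ⊔ maximalIdeal R ^ ν)
    (hf' : f ∉ Ideal.span (z '' S) ⊔ maximalIdeal R ^ (ν + 1)) (s : Finset (Ideal R))
    (hprime : ∀ Q ∈ s, Q.IsPrime) (hle : ∀ Q ∈ s, Ideal.span (z '' S) ⊔ Ideal.span {f} ≤ Q)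
    (hanti : ∀ P ∈ s, ∀ Q ∈ s, P ≤ Q → P = Q)
    (hdim : ∀ Q ∈ s, ringKrullDim (R ⧸ Q) + 1 = ringKrullDim (R ⧸ Ideal.span (z '' S))) :
    s.card ≤ ν := by
  classical
  rcases s.eq_empty_or_nonempty with rfl | ⟨Q₀, hQ₀⟩
  · simp
  set 𝔞 := Ideal.span (z '' S) with h𝔞
  set θ : {i // i ∉ S} → R := fun i => z i with hθ
  have hsup : 𝔞 ⊔ Ideal.span (Set.range θ) = maximalIdeal R :=
    span_image_sup_span_compl hz.span_eq S
  have hν : ν ≠ 0 := by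
    rintro rfl
    have h1 : f ∈ Q₀ := hle Q₀ hQ₀ (Ideal.mem_sup_right (Ideal.mem_span_singleton_self f))
    refine hf' (Ideal.mem_sup_right ?_)
    rw [zero_add, pow_one]
    exact le_maximalIdeal (hprime Q₀ hQ₀).ne_top h1
  obtain ⟨F, hF, hfF, hF0⟩ := exists_leadingForm hsup hf hf'
  obtain ⟨j, b, u, hu, hline, hFu⟩ := exists_line hF hν hF0 θ
  have hθm : ∀ i, θ i ∈ maximalIdeal R := fun i =>
    hz.span_eq ▸ Ideal.subset_span (Set.mem_range_self _)
  have hpow : θ j ^ ν ∈ 𝔞 ⊔ Ideal.span {f} ⊔ lineIdeal θ b j := by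
    refine (Ideal.unit_mul_mem_iff_mem _ hu).1 ?_
    have e : u * θ j ^ ν = (f - (f - MvPolynomial.eval θ F)) -
      (MvPolynomial.eval θ F - u * θ j ^ ν) := by ring
    rw [e]
    refine sub_mem (Ideal.mem_sup_left (sub_mem ?_ (Ideal.mem_sup_left hfF)))
      (Ideal.mem_sup_right hFu)
    exact Ideal.mem_sup_right (Ideal.mem_span_singleton_self f)
  have hmle : maximalIdeal R ≤ 𝔞 ⊔ Ideal.span {f} ⊔ lineIdeal θ b j ⊔ Ideal.span {θ j} := by
    rw [← hsup]
    refine sup_le (le_sup_of_le_left (le_sup_of_le_left le_sup_left)) (hline.trans ?_)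
    exact sup_le_sup_right le_sup_right _
  -- The forms cutting out the line are parameters on the hypersurface. Together with `𝔞`, `f` and
  -- `θ j` they generate an ideal containing `𝔪`, and `θ j ^ ν` is already in the ideal without `θ
  -- j`, so the colength is at most `ν`.
  refine card_le_of_colength_le (κ := {i : {i // i ∉ S} // i ≠ j})
    (𝔞 := 𝔞 ⊔ Ideal.span {f}) (z := fun i => θ i - b i * θ j) ?_ ?_ ?_ s hprime hle hanti ?_
  · exact fun i => sub_mem (hθm _) (Ideal.mul_mem_left _ _ (hθm _))
  · refine hmle.trans (sup_le Ideal.le_radical ?_)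
    rw [Ideal.span_singleton_le_iff_mem]
    exact ⟨ν, hpow⟩
  · change colength (𝔞 ⊔ Ideal.span {f} ⊔ lineIdeal θ b j) ≤ ν
    have h1 := colength_sup_pow_le (𝔞 ⊔ Ideal.span {f} ⊔ lineIdeal θ b j) (θ j) ν
    rw [sup_eq_left.2 ((Ideal.span_singleton_le_iff_mem _).2 hpow)] at h1
    refine h1.trans ?_
    calc (ν : ℕ∞) * _ ≤ ν * 1 := by
          gcongr
          rw [← colength_maximalIdeal (R := R)]
          exact colength_anti hmle
      _ = ν := mul_one _
  · intro Q hQ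
    have h1 := hz.card_le_ringKrullDim S
    rw [← hdim Q hQ] at h1
    have h2 : Nat.card {i // i ∉ S} = Nat.card {i : {i // i ∉ S} // i ≠ j} + 1 := by
      rw [← Finite.card_option]
      exact Nat.card_congr (Equiv.optionSubtypeNe j).symm
    rw [h2] at h1
    exact natCast_le_of_add_le h1

end Coordinates

/-! ### Comparison of the divisor with the monomial model. -/

section Comparison

variable {R ι : Type*} [CommRing R] [IsLocalRing R] [Fintype ι]

/-- The length of `R / (I + 𝔪^N)` as a natural number. -/
noncomputable def truncLength (I : Ideal R) (N : ℕ) : ℕ :=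
  (colength (I ⊔ maximalIdeal R ^ N)).toNat

lemma colength_sup_pow_ne_top {z : ι → R} (hz : Ideal.span (Set.range z) = maximalIdeal R)
    (I : Ideal R) (N : ℕ) : colength (I ⊔ maximalIdeal R ^ N) ≠ ⊤ := by
  have hset : degGE ι N ∪ ↑(degLT ι N) = Set.univ := by
    ext α
    simp only [Set.mem_union, mem_degGE, Finset.mem_coe, mem_degLT, Set.mem_univ, iff_true]
    omega
  have h := colength_sup_monIdeal_le I z (degLT ι N) (degGE ι N) (isUpperSet_degGE _)
    (hset ▸ isUpperSet_univ)
  rw [hset, monIdeal_univ, sup_top_eq, colength_top, zero_add, monIdeal_degGE, hz] at h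
  refine ne_top_of_le_ne_top ?_ (h.trans (mul_le_mul_right
    ((colength_anti le_sup_right).trans colength_maximalIdeal.le) _))
  rw [mul_one]
  exact ENat.natCast_ne_top _

lemma coe_truncLength {z : ι → R} (hz : Ideal.span (Set.range z) = maximalIdeal R)
    (I : Ideal R) (N : ℕ) : (truncLength I N : ℕ∞) = colength (I ⊔ maximalIdeal R ^ N) :=
  ENat.natCast_toNat (colength_sup_pow_ne_top hz I N)

lemma truncLength_anti {z : ι → R} (hz : Ideal.span (Set.range z) = maximalIdeal R)
    {I J : Ideal R} {N : ℕ} (h : I ≤ J ⊔ maximalIdeal R ^ N) :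
    truncLength J N ≤ truncLength I N := by
  have := colength_anti (sup_le h le_sup_right)
  rw [← coe_truncLength hz, ← coe_truncLength hz] at this
  exact_mod_cast this

lemma truncLength_lt {z : ι → R} (hz : Ideal.span (Set.range z) = maximalIdeal R)
    {I J : Ideal R} {N : ℕ} (h : I ≤ J) {x : R} (hx : x ∈ J)
    (hxI : x ∉ I ⊔ maximalIdeal R ^ N) : truncLength J N < truncLength I N := by
  have hlt : I ⊔ maximalIdeal R ^ N < J ⊔ maximalIdeal R ^ N :=
    lt_of_le_of_ne (sup_le_sup_right h _) fun he => hxI (he ▸ Ideal.mem_sup_left hx)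
  have := colength_add_one_le hlt
  rw [← coe_truncLength hz, ← coe_truncLength hz] at this
  exact_mod_cast this

/-- Mayer–Vietoris for the truncated ideals; only an inequality remains because `I ∩ J + 𝔪^N` may be
smaller than the intersection of the truncations. -/
lemma truncLength_add_le {z : ι → R} (hz : Ideal.span (Set.range z) = maximalIdeal R)
    (I J : Ideal R) (N : ℕ) :
    truncLength I N + truncLength J N ≤ truncLength (I ⊓ J) N + truncLength (I ⊔ J) N := by
  have h := colength_inf_add_sup (I ⊔ maximalIdeal R ^ N) (J ⊔ maximalIdeal R ^ N)
  have h1 : colength ((I ⊔ maximalIdeal R ^ N) ⊓ (J ⊔ maximalIdeal R ^ N)) ≤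
      colength (I ⊓ J ⊔ maximalIdeal R ^ N) := colength_anti
    (le_inf (sup_le_sup_right inf_le_left _) (sup_le_sup_right inf_le_right _))
  rw [← sup_sup_distrib_right, ← coe_truncLength hz, ← coe_truncLength hz,
    ← coe_truncLength hz] at h
  rw [← coe_truncLength hz] at h1
  have h2 : ((truncLength I N + truncLength J N : ℕ) : ℕ∞) ≤
      (truncLength (I ⊓ J) N + truncLength (I ⊔ J) N : ℕ) := by
    rw [Nat.cast_add, ← h, Nat.cast_add]
    gcongr
  exact_mod_cast h2

lemma truncLength_add_eq {z : ι → R} (hz : Ideal.span (Set.range z) = maximalIdeal R)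
    {I J : Ideal R} {N : ℕ} (hIJ : (I ⊔ maximalIdeal R ^ N) ⊓ (J ⊔ maximalIdeal R ^ N) ≤
      I ⊓ J ⊔ maximalIdeal R ^ N) :
    truncLength I N + truncLength J N = truncLength (I ⊓ J) N + truncLength (I ⊔ J) N := by
  have h := colength_inf_add_sup (I ⊔ maximalIdeal R ^ N) (J ⊔ maximalIdeal R ^ N)
  rw [le_antisymm hIJ
    (le_inf (sup_le_sup_right inf_le_left _) (sup_le_sup_right inf_le_right _)),
    ← sup_sup_distrib_right, ← coe_truncLength hz, ← coe_truncLength hz,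
    ← coe_truncLength hz, ← coe_truncLength hz] at h
  exact_mod_cast h.symm

lemma IsRegularCoordinates.truncLength_le_of_mem {z : ι → R}
    (hz : IsRegularCoordinates z) {S : Set ι} {f : R} {q : ℕ}
    (hf : f ∈ Ideal.span (z '' S) ⊔ maximalIdeal R ^ q) (N : ℕ) :
    truncLength (Ideal.span (z '' S)) N ≤
      truncLength (Ideal.span (z '' S) ⊔ Ideal.span {f}) N +
        truncLength (Ideal.span (z '' S)) (N - q) := by
  have := colength_le_add_of_mem hf N
  rw [← coe_truncLength hz.span_eq, ← coe_truncLength hz.span_eq,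
    ← coe_truncLength hz.span_eq] at this
  exact_mod_cast this

lemma IsRegularCoordinates.mon_mem_pow {z : ι → R} (hz : IsRegularCoordinates z)
    {S : Set ι} {β : ι →₀ ℕ} :
    mon z β ∈ Ideal.span (z '' S) ⊔ maximalIdeal R ^ β.degree :=
  Ideal.mem_sup_right (hz.span_eq ▸ StableSnc.mon_mem_pow z β)

lemma monIdeal_sup_sup_of_le {R ι : Type*} [CommRing R] {S : Set ι} {G : Set (ι →₀ ℕ)}
    {β γ : ι →₀ ℕ} (z : ι → R) (hβγ : β ≤ γ) :
    monIdeal z (G ∪ Set.Ici β) ⊔ (monIdeal z (G ∪ Set.Ici γ) ⊔ Ideal.span (z '' S)) =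
      monIdeal z (G ∪ Set.Ici β) ⊔ Ideal.span (z '' S) := by
  rw [← sup_assoc, sup_eq_left.2 (monIdeal_mono z
    (Set.union_subset_union_right G (Set.Ici_subset_Ici.2 hβγ)))]

variable [IsNoetherianRing R]

/-- Monomial ideals correspond to sets of exponents, where intersection distributes over union, and
`𝔪^N` is itself monomial. -/
lemma IndepMod.inf_sup_pow_le {z : ι → R} (h : IndepMod ⊥ z)
    (hz : Ideal.span (Set.range z) = maximalIdeal R) {U V : Set (ι →₀ ℕ)} (hU : IsUpperSet U)
    (hV : IsUpperSet V) (N : ℕ) :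
    (monIdeal z U ⊔ maximalIdeal R ^ N) ⊓ (monIdeal z V ⊔ maximalIdeal R ^ N) ≤
      monIdeal z U ⊓ monIdeal z V ⊔ maximalIdeal R ^ N := by
  rw [← hz, ← monIdeal_degGE, ← monIdeal_union, ← monIdeal_union,
    h.monIdeal_inf hz (hU.union (isUpperSet_degGE N)) (hV.union (isUpperSet_degGE N)),
    h.monIdeal_inf hz hU hV, ← monIdeal_union, Set.inter_union_distrib_right]

variable [Infinite (ResidueField R)] {z : ι → R} (hz : IsRegularCoordinates z) {S : Set ι}
  {G : Set (ι →₀ ℕ)} (hG : IsUpperSet G)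
include hz

lemma IsRegularCoordinates.truncLength_eq_of_mem {f : R} {q : ℕ}
    (hf : f ∈ Ideal.span (z '' S) ⊔ maximalIdeal R ^ q)
    (hf' : f ∉ Ideal.span (z '' S) ⊔ maximalIdeal R ^ (q + 1)) (N : ℕ) :
    truncLength (Ideal.span (z '' S)) N =
      truncLength (Ideal.span (z '' S) ⊔ Ideal.span {f}) N +
        truncLength (Ideal.span (z '' S)) (N - q) := by
  have := (hz.indepMod S).colength_eq_add (span_image_sup_span_compl hz.span_eq S) hf hf' N
  rw [← coe_truncLength hz.span_eq, ← coe_truncLength hz.span_eq,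
    ← coe_truncLength hz.span_eq] at this
  exact_mod_cast this

lemma IsRegularCoordinates.mon_notMem_pow {β : ι →₀ ℕ} (hβ : ∀ i ∈ S, β i = 0) :
    mon z β ∉ Ideal.span (z '' S) ⊔ maximalIdeal R ^ (β.degree + 1) := by
  rw [← monIdeal_exists_ne_zero]
  refine hz.indepMod_bot.mon_notMem_monIdeal hz.span_eq (isUpperSet_exists_ne_zero S) ?_
    (Nat.lt_succ_self _)
  rintro ⟨i, hi, h⟩
  exact h (hβ i hi)

include hG

/-- The Hilbert-Samuel function of the normal crossings model. -/
lemma IsRegularCoordinates.truncLength_model (β : ι →₀ ℕ) (N : ℕ) :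
    truncLength (monIdeal z (G ∪ Set.Ici β)) N +
      truncLength (Ideal.span (z '' S) ⊔ Ideal.span {mon z β}) N =
    truncLength (monIdeal z (G ∪ Set.Ici β) ⊓ (Ideal.span (z '' S) ⊔ Ideal.span {mon z β})) N +
      truncLength (monIdeal z (G ∪ Set.Ici β) ⊔ Ideal.span (z '' S)) N := by
  have h : monIdeal z (G ∪ Set.Ici β) ⊔ Ideal.span (z '' S) =
      monIdeal z (G ∪ Set.Ici β) ⊔ (Ideal.span (z '' S) ⊔ Ideal.span {mon z β}) := by
    rw [sup_comm (Ideal.span (z '' S)), ← sup_assoc]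
    congr 1
    rw [left_eq_sup, ← monIdeal_Ici]
    exact monIdeal_mono z Set.subset_union_right
  rw [h]
  refine truncLength_add_eq hz.span_eq ?_
  rw [← monIdeal_exists_ne_zero, ← monIdeal_Ici, ← monIdeal_union]
  exact hz.indepMod_bot.inf_sup_pow_le hz.span_eq (hG.union (isUpperSet_Ici β))
    ((isUpperSet_exists_ne_zero S).union (isUpperSet_Ici β)) N

/-- Mayer–Vietoris for `A_β` and `A_γ + P`: their sum is `A_β + P` and their intersection contains
`A_γ`. -/
lemma IsRegularCoordinates.truncLength_mono_exponent {β γ : ι →₀ ℕ} (hβγ : β ≤ γ) (N : ℕ) :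
    truncLength (monIdeal z (G ∪ Set.Ici β)) N +
      truncLength (monIdeal z (G ∪ Set.Ici γ) ⊔ Ideal.span (z '' S)) N ≤
    truncLength (monIdeal z (G ∪ Set.Ici γ)) N +
      truncLength (monIdeal z (G ∪ Set.Ici β) ⊔ Ideal.span (z '' S)) N := by
  have h := truncLength_add_le hz.span_eq (monIdeal z (G ∪ Set.Ici β))
    (monIdeal z (G ∪ Set.Ici γ) ⊔ Ideal.span (z '' S)) N
  rw [monIdeal_sup_sup_of_le z hβγ] at h
  refine h.trans (add_le_add (truncLength_anti hz.span_eq (le_sup_of_le_left (le_inf ?_ ?_))) le_rfl)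
  · exact monIdeal_mono z (Set.union_subset_union_right G (Set.Ici_subset_Ici.2 hβγ))
  · exact le_sup_left

/-- Strictness is witnessed by the monomial `z_i z^β`: it lies in `A_β ∩ P` but not in `A_γ + 𝔪^N`,
having degree `|β| + 1 < N`. -/
lemma IsRegularCoordinates.truncLength_lt_exponent {β γ : ι →₀ ℕ} (hβγ : β ≤ γ)
    (hγ : ∀ i ∈ S, γ i = 0) (hdeg : β.degree < γ.degree) {i : ι} (hi : i ∈ S)
    (hGβ : Finsupp.single i 1 + β ∉ G) {N : ℕ} (hN : β.degree + 1 < N) :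
    truncLength (monIdeal z (G ∪ Set.Ici β)) N +
      truncLength (monIdeal z (G ∪ Set.Ici γ) ⊔ Ideal.span (z '' S)) N <
    truncLength (monIdeal z (G ∪ Set.Ici γ)) N +
      truncLength (monIdeal z (G ∪ Set.Ici β) ⊔ Ideal.span (z '' S)) N := by
  classical
  have h := truncLength_add_le hz.span_eq (monIdeal z (G ∪ Set.Ici β))
    (monIdeal z (G ∪ Set.Ici γ) ⊔ Ideal.span (z '' S)) N
  rw [monIdeal_sup_sup_of_le z hβγ] at h
  refine h.trans_lt (add_lt_add_left (truncLength_lt hz.span_eq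
    (x := mon z (Finsupp.single i 1 + β)) (le_inf ?_ ?_) ⟨?_, ?_⟩ ?_) _)
  · exact monIdeal_mono z (Set.union_subset_union_right G (Set.Ici_subset_Ici.2 hβγ))
  · exact le_sup_left
  · exact mon_mem_monIdeal z (Or.inr (Set.mem_Ici.2 le_add_self))
  · refine Ideal.mem_sup_right ?_
    rw [mon_add, mon_single, pow_one]
    exact Ideal.mul_mem_right _ _ (Ideal.subset_span ⟨i, hi, rfl⟩)
  · refine hz.indepMod_bot.mon_notMem_monIdeal hz.span_eq (hG.union (isUpperSet_Ici γ)) ?_ ?_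
    · rintro (h1 | h1)
      · exact hGβ h1
      -- As `|γ| ≥ |β| + 1`, divisibility by `z^γ` would force equality of exponents, but `γ`
      -- vanishes at `i`.
      · obtain ⟨δ, hδ⟩ := exists_add_of_le (Set.mem_Ici.1 h1)
        have hd := congrArg Finsupp.degree hδ
        rw [map_add, map_add, Finsupp.degree_single] at hd
        have h0 : δ.degree = 0 := by omega
        rw [Finsupp.degree_eq_zero_iff] at h0
        rw [h0, add_zero] at hδ
        have := DFunLike.congr_fun hδ i
        rw [Finsupp.add_apply, Finsupp.single_eq_same, hγ i hi] at this
        omega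
    · rw [map_add, Finsupp.degree_single]
      omega

/-- The Hilbert-Samuel function of the divisor exceeds that of the model in some degree as soon as
one of the three extremality conditions fails. -/
lemma IsRegularCoordinates.exists_truncLength_model_lt {β γ : ι →₀ ℕ} (hβγ : β ≤ γ)
    (hβ : ∀ i ∈ S, β i = 0) (hγ : ∀ i ∈ S, γ i = 0) {i : ι} (hi : i ∈ S)
    (hGβ : Finsupp.single i 1 + β ∉ G) {f : R}
    (hf : f ∈ Ideal.span (z '' S) ⊔ maximalIdeal R ^ β.degree)
    (hstrict : f ∈ Ideal.span (z '' S) ⊔ maximalIdeal R ^ (β.degree + 1) ∨ β.degree < γ.degree ∨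
      f ∉ monIdeal z (G ∪ Set.Ici γ) ⊔ Ideal.span (z '' S)) :
    ∃ k, truncLength (monIdeal z (G ∪ Set.Ici β) ⊓
        (Ideal.span (z '' S) ⊔ Ideal.span {mon z β})) (k + 1) <
      truncLength (monIdeal z (G ∪ Set.Ici γ) ⊓ (Ideal.span (z '' S) ⊔ Ideal.span {f})) (k + 1) := by
  have h1 := truncLength_add_le hz.span_eq (monIdeal z (G ∪ Set.Ici γ))
    (Ideal.span (z '' S) ⊔ Ideal.span {f})
  have h2 := hz.truncLength_model (S := S) hG β
  have h3 : ∀ N, truncLength (monIdeal z (G ∪ Set.Ici γ) ⊔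
      (Ideal.span (z '' S) ⊔ Ideal.span {f})) N ≤
      truncLength (monIdeal z (G ∪ Set.Ici γ) ⊔ Ideal.span (z '' S)) N := fun N =>
    truncLength_anti hz.span_eq (le_sup_of_le_left (sup_le_sup_left le_sup_left _))
  have h4 := hz.truncLength_mono_exponent (S := S) hG hβγ
  have h5 := hz.truncLength_eq_of_mem (S := S) hz.mon_mem_pow (hz.mon_notMem_pow hβ)
  have h6 := hz.truncLength_le_of_mem (S := S) hf
  rcases hstrict with h | h | h
  -- Order too large: modulo `𝔪^(|β|+1)` adding `f` to `P` has no effect, whereas adding `z^β`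
  -- lowers the length by that of `R/(P + 𝔪)`.
  · refine ⟨β.degree, ?_⟩
    have h7 : truncLength (Ideal.span (z '' S)) (β.degree + 1) ≤
        truncLength (Ideal.span (z '' S) ⊔ Ideal.span {f}) (β.degree + 1) :=
      truncLength_anti hz.span_eq
        (sup_le le_sup_left ((Ideal.span_singleton_le_iff_mem _).2 h))
    have h8 : 0 < truncLength (Ideal.span (z '' S)) (β.degree + 1 - β.degree) := by
      rw [Nat.add_sub_cancel_left]
      refine (Nat.zero_le _).trans_lt (truncLength_lt hz.span_eq (J := ⊤) le_top
        (x := 1) trivial ?_)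
      rw [pow_one, ← Ideal.ne_top_iff_one]
      refine ne_top_of_le_ne_top (maximalIdeal.isMaximal R).ne_top (sup_le ?_ le_rfl)
      rw [← hz.span_eq]
      exact Ideal.span_mono (Set.image_subset_range _ _)
    specialize h1 (β.degree + 1); specialize h2 (β.degree + 1); specialize h3 (β.degree + 1)
    specialize h4 (β.degree + 1); specialize h5 (β.degree + 1)
    omega
  -- Too many factors `y_j`: the truncation at `|β| + 2` is the first to see the monomial `z_i z^β`
  -- of degree `|β| + 1`.
  · refine ⟨β.degree + 1, ?_⟩
    have h7 := hz.truncLength_lt_exponent hG hβγ hγ h hi hGβ (Nat.lt_succ_self _)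
    specialize h1 (β.degree + 1 + 1); specialize h2 (β.degree + 1 + 1)
    specialize h3 (β.degree + 1 + 1); specialize h5 (β.degree + 1 + 1)
    specialize h6 (β.degree + 1 + 1)
    simp only [Nat.succ_eq_add_one] at h7
    omega
  -- When `f ∉ J`, Krull's theorem gives a truncation at which adding `f` to `J` strictly lowers the
  -- length.
  · obtain ⟨k, hk⟩ : ∃ k, f ∉ monIdeal z (G ∪ Set.Ici γ) ⊔ Ideal.span (z '' S) ⊔
        maximalIdeal R ^ (k + 1) := by
      obtain ⟨k, -, hk⟩ := exists_mem_sup_pow_notMem h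
      exact ⟨k, hk⟩
    refine ⟨k, ?_⟩
    have h7 : truncLength (monIdeal z (G ∪ Set.Ici γ) ⊔
        (Ideal.span (z '' S) ⊔ Ideal.span {f})) (k + 1) <
        truncLength (monIdeal z (G ∪ Set.Ici γ) ⊔ Ideal.span (z '' S)) (k + 1) :=
      truncLength_lt hz.span_eq (sup_le_sup_left le_sup_left _) (x := f)
        (Ideal.mem_sup_right (Ideal.mem_sup_right (Ideal.mem_span_singleton_self f))) hk
    specialize h1 (k + 1); specialize h2 (k + 1); specialize h4 (k + 1)
    specialize h5 (k + 1); specialize h6 (k + 1)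
    omega

/-- The case of equality. -/
lemma IsRegularCoordinates.truncLength_model_eq {β : ι →₀ ℕ}
    (hβ : ∀ i ∈ S, β i = 0) {f : R}
    (hf : f ∈ Ideal.span (z '' S) ⊔ maximalIdeal R ^ β.degree)
    (hf' : f ∉ Ideal.span (z '' S) ⊔ maximalIdeal R ^ (β.degree + 1))
    (hJ : f ∈ monIdeal z (G ∪ Set.Ici β) ⊔ Ideal.span (z '' S)) (N : ℕ) :
    truncLength (monIdeal z (G ∪ Set.Ici β) ⊓ (Ideal.span (z '' S) ⊔ Ideal.span {f})) N =
      truncLength (monIdeal z (G ∪ Set.Ici β) ⊓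
        (Ideal.span (z '' S) ⊔ Ideal.span {mon z β})) N := by
  have h2 := hz.truncLength_model (S := S) hG β N
  have h5 := hz.truncLength_eq_of_mem (S := S) hz.mon_mem_pow (hz.mon_notMem_pow hβ) N
  have h6 := hz.truncLength_eq_of_mem (S := S) hf hf' N
  set A := monIdeal z (G ∪ Set.Ici β) with hA
  set P := Ideal.span (z '' S) with hP
  -- Since `f ∈ A + P`, it can be replaced by some `f₀ ∈ A` without changing `P + (f)`.
  obtain ⟨f₀, hf₀, p, hp, hsum⟩ := Submodule.mem_sup.1 hJ
  have hB : P ⊔ Ideal.span {f} = P ⊔ Ideal.span {f₀} := by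
    refine le_antisymm (sup_le le_sup_left ?_) (sup_le le_sup_left ?_) <;>
      rw [Ideal.span_singleton_le_iff_mem]
    · rw [← hsum, add_comm]
      exact Submodule.add_mem_sup hp (Ideal.mem_span_singleton_self _)
    · have : f₀ = -p + f := by rw [← hsum]; ring
      rw [this]
      exact Submodule.add_mem_sup (neg_mem hp) (Ideal.mem_span_singleton_self _)
  have hAP : (A ⊔ maximalIdeal R ^ N) ⊓ (P ⊔ maximalIdeal R ^ N) ≤
      A ⊓ P ⊔ maximalIdeal R ^ N := by
    rw [hP, ← monIdeal_exists_ne_zero]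
    exact hz.indepMod_bot.inf_sup_pow_le hz.span_eq (hG.union (isUpperSet_Ici β))
      (isUpperSet_exists_ne_zero S) N
  -- The modular law `A ∩ (P + (f₀)) = A ∩ P + (f₀)`, carried out modulo `𝔪^N`; it reduces the
  -- compatibility with truncation to that of the monomial ideals `A` and `P`.
  have h1 := truncLength_add_eq hz.span_eq (I := A) (J := P ⊔ Ideal.span {f₀}) (N := N) (by
    rintro x ⟨hx1, hx2⟩
    obtain ⟨a, ha, μ, hμ, rfl⟩ := Submodule.mem_sup.1 hx1
    obtain ⟨b, hb, μ', hμ', hx⟩ := Submodule.mem_sup.1 hx2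
    obtain ⟨i, hi, c, hc, rfl⟩ := Submodule.mem_sup.1 hb
    obtain ⟨t, rfl⟩ := Ideal.mem_span_singleton'.1 hc
    have h7 : a - t * f₀ ∈ A ⊓ P ⊔ maximalIdeal R ^ N := by
      refine hAP ⟨Ideal.mem_sup_left (sub_mem ha (Ideal.mul_mem_left _ _ hf₀)), ?_⟩
      have : a - t * f₀ = i + (μ' - μ) := by linear_combination -hx
      rw [this]
      exact Submodule.add_mem_sup hi (sub_mem hμ' hμ)
    obtain ⟨u, hu, v, hv, huv⟩ := Submodule.mem_sup.1 h7
    have : a + μ = (u + t * f₀) + (v + μ) := by linear_combination -huv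
    rw [this]
    refine Submodule.add_mem_sup ⟨add_mem hu.1 (Ideal.mul_mem_left _ _ hf₀),
      Submodule.add_mem_sup hu.2 (Ideal.mul_mem_left _ _ (Ideal.mem_span_singleton_self _))⟩
      (add_mem hv hμ))
  have h8 : A ⊔ (P ⊔ Ideal.span {f₀}) = A ⊔ P := by
    rw [sup_comm P, ← sup_assoc, sup_eq_left.2 ((Ideal.span_singleton_le_iff_mem _).2 hf₀)]
  rw [h8, ← hB] at h1
  omega

end Comparison

/-! ### Orders as membership conditions. -/

section Order

variable {R : Type*} [CommRing R] [IsLocalRing R]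

lemma natCast_le_orderOn {I : Ideal R} {f : R} {n : ℕ} (h : f ∈ I ⊔ maximalIdeal R ^ n) :
    (n : ℕ∞) ≤ orderOn I f :=
  le_iSup₂ (f := fun (n : ℕ) (_ : f ∈ I ⊔ maximalIdeal R ^ n) => (n : ℕ∞)) n h

lemma orderOn_le_of_notMem {I : Ideal R} {f : R} {n : ℕ}
    (h : f ∉ I ⊔ maximalIdeal R ^ (n + 1)) : orderOn I f ≤ n := by
  refine iSup₂_le fun m hm => Nat.cast_le.2 ?_
  by_contra! hlt
  have : I ⊔ maximalIdeal R ^ m ≤ I ⊔ maximalIdeal R ^ (n + 1) :=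
    sup_le_sup_left (Ideal.pow_le_pow_right hlt) _
  exact h (this hm)

lemma natCast_lt_orderOn_iff {I : Ideal R} {f : R} {n : ℕ} :
    (n : ℕ∞) < orderOn I f ↔ f ∈ I ⊔ maximalIdeal R ^ (n + 1) := by
  constructor
  · intro h
    by_contra hf
    exact (orderOn_le_of_notMem hf).not_gt h
  · intro h
    exact lt_of_lt_of_le (Nat.cast_lt.2 (Nat.lt_succ_self n)) (natCast_le_orderOn h)

lemma orderOn_eq_natCast_iff {I : Ideal R} {f : R} {n : ℕ} :
    orderOn I f = n ↔ f ∈ I ⊔ maximalIdeal R ^ n ∧ f ∉ I ⊔ maximalIdeal R ^ (n + 1) := by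
  constructor
  · intro h
    refine ⟨?_, fun hf => (natCast_lt_orderOn_iff.2 hf).ne' h⟩
    rcases n with _ | n
    · simp
    · exact natCast_lt_orderOn_iff.1 (h ▸ Nat.cast_lt.2 (Nat.lt_succ_self n))
  · rintro ⟨h1, h2⟩
    exact le_antisymm (orderOn_le_of_notMem h2) (natCast_le_orderOn h1)

lemma orderOn_mono {I J : Ideal R} (h : I ≤ J) (f : R) : orderOn I f ≤ orderOn J f :=
  iSup₂_le fun _ hn => natCast_le_orderOn ((sup_le_sup_right h _ : _ ≤ J ⊔ _) hn)

end Order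

lemma infinite_residueField (K A : Type*) [Field K] [CharZero K] [CommRing A] [IsLocalRing A]
    [Algebra K A] : Infinite (ResidueField A) := by
  have : Infinite K := inferInstance
  exact Infinite.of_injective ((residue A).comp (algebraMap K A)) (RingHom.injective _)

/-! ### Squarefree exponents and change of ambient ring. -/

section Exponents

variable {R ι : Type*} [CommRing R]

/-- The exponent of the product of the variables in `s`. -/
noncomputable def expOf (s : Finset ι) : ι →₀ ℕ := ∑ i ∈ s, Finsupp.single i 1

lemma expOf_apply [DecidableEq ι] (s : Finset ι) (i : ι) :
    expOf s i = if i ∈ s then 1 else 0 := by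
  rw [expOf, Finsupp.finsetSum_apply]
  simp [Finsupp.single_apply]

lemma mon_expOf (z : ι → R) (s : Finset ι) : mon z (expOf s) = ∏ i ∈ s, z i := by
  classical
  induction s using Finset.induction_on with
  | empty => simp [expOf, mon_zero]
  | insert i s hi ih =>
    rw [expOf, Finset.sum_insert hi, mon_add, mon_single, pow_one, Finset.prod_insert hi, ← ih]
    rfl

lemma degree_expOf (s : Finset ι) : (expOf s).degree = s.card := by
  rw [expOf, map_sum]
  simp

lemma expOf_le_iff (s : Finset ι) (α : ι →₀ ℕ) : expOf s ≤ α ↔ ∀ i ∈ s, α i ≠ 0 := by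
  classical
  constructor
  · intro h i hi
    have := h i
    rw [expOf_apply, if_pos hi] at this
    omega
  · intro h i
    rw [expOf_apply]
    split_ifs with hi
    · exact Nat.one_le_iff_ne_zero.2 (h i hi)
    · exact Nat.zero_le _

lemma expOf_mono {s t : Finset ι} (h : s ⊆ t) : expOf s ≤ expOf t := by
  classical
  rw [expOf_le_iff]
  intro i hi
  rw [expOf_apply, if_pos (h hi)]
  exact one_ne_zero

/-- The colength of a monomial ideal does not depend on the ambient ring. -/
lemma IndepMod.colength_congr {A B ι' : Type*} [CommRing A] [IsLocalRing A] [CommRing B]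
    [IsLocalRing B] [Finite ι] [Finite ι'] {z : ι → A} {z' : ι' → B} (h : IndepMod ⊥ z)
    (hz : Ideal.span (Set.range z) = maximalIdeal A) (h' : IndepMod ⊥ z')
    (hz' : Ideal.span (Set.range z') = maximalIdeal B) (e : ι ≃ ι') {U : Set (ι →₀ ℕ)}
    {U' : Set (ι' →₀ ℕ)} (hU : IsUpperSet U) (hU' : IsUpperSet U')
    (hUU' : ∀ α, α ∈ U ↔ Finsupp.equivMapDomain e α ∈ U') (N : ℕ) :
    colength (monIdeal z U ⊔ maximalIdeal A ^ N) =
      colength (monIdeal z' U' ⊔ maximalIdeal B ^ N) := by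
  classical
  have hdeg : ∀ α : ι →₀ ℕ, (Finsupp.equivMapDomain e α).degree = α.degree := fun α => by
    rw [Finsupp.equivMapDomain_eq_mapDomain, Finsupp.degree_mapDomain]
  rw [← hz, ← hz', ← monIdeal_degGE, ← monIdeal_degGE, ← monIdeal_union, ← monIdeal_union,
    h.colength_monIdeal hz (hU.union (isUpperSet_degGE N)) ((degLT ι N).filter (· ∉ U))
      (by simp [and_comm]),
    h'.colength_monIdeal hz' (hU'.union (isUpperSet_degGE N)) ((degLT ι' N).filter (· ∉ U'))
      (by simp [and_comm]), Nat.cast_inj]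
  refine Finset.card_bij' (fun α _ => Finsupp.equivMapDomain e α)
    (fun α _ => Finsupp.equivMapDomain e.symm α) ?_ ?_ ?_ ?_
  · intro α hα
    simp only [Finset.mem_filter, mem_degLT, hdeg] at hα ⊢
    exact ⟨hα.1, fun h => hα.2 ((hUU' α).2 h)⟩
  · intro α hα
    have e1 : Finsupp.equivMapDomain e (Finsupp.equivMapDomain e.symm α) = α := by
      ext; simp
    simp only [Finset.mem_filter, mem_degLT] at hα ⊢
    rw [hUU', e1, ← hdeg, e1]
    exact hα
  · intro α _
    ext; simp
  · intro α _
    ext; simp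

end Exponents

/-! ### Components of the divisor and of `X`. -/

section Primes

variable {R : Type*} [CommRing R]

lemma exists_le_of_iInf_le {τ : Type*} [Finite τ] {P : τ → Ideal R} {Q : Ideal R} (hQ : Q.IsPrime)
    (h : ⨅ i, P i ≤ Q) : ∃ i, P i ≤ Q := by
  have := Fintype.ofFinite τ
  rw [← Finset.inf_univ_eq_iInf, hQ.inf_le'] at h
  obtain ⟨i, -, hi⟩ := h
  exact ⟨i, hi⟩

/-- A component of `D` outside of the singular locus of `X` lies in only one component of `X`. -/
lemma component_unique {K : Type*} [Field K] [CharZero K] [Algebra K R] {IX ID Q : Ideal R}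
    {τ : Type*} [Finite τ] {P : τ → Ideal R} (hIX : IX = ⨅ i, P i)
    (hP : ∀ i, P i ∈ IX.minimalPrimes) (hinj : Function.Injective P)
    (hle : IX ≤ ID) (hsing : NoComponentInSing IX ID) (hQ : Q ∈ ID.minimalPrimes) {i j : τ}
    (hi : P i ≤ Q) (hj : P j ≤ Q) : i = j := by
  classical
  have hQp : Q.IsPrime := hQ.1.1
  have hIQ : IX ≤ Q := hle.trans hQ.1.2
  have hker : RingHom.ker (Ideal.Quotient.mk IX) ≤ Q := by rwa [Ideal.mk_ker]
  have hprime : (Q.map (Ideal.Quotient.mk IX)).IsPrime :=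
    Ideal.map_isPrime_of_surjective Ideal.Quotient.mk_surjective hker
  have hcomap : (Q.map (Ideal.Quotient.mk IX)).comap (Ideal.Quotient.mk IX) = Q := by
    rw [Ideal.comap_map_of_surjective _ Ideal.Quotient.mk_surjective, ← RingHom.ker_eq_comap_bot,
      sup_eq_left.2 hker]
  let Q' : PrimeSpectrum (R ⧸ IX) := ⟨_, hprime⟩
  have hreg : IsRegularLocalRing (Localization.AtPrime Q'.asIdeal) :=
    hsing Q' (by rw [show Q'.asIdeal = _ from rfl, hcomap]; exact hQ)
  have : Infinite (ResidueField (Localization.AtPrime Q'.asIdeal)) :=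
    infinite_residueField K _
  -- The local ring of `X` at the generic point of `V(Q)` is a domain, so the kernel of `R` into it
  -- is prime. It contains some `P l` and is contained in every `P l'` that lies in `Q`, so
  -- minimality leaves only one such component.
  have hdom := isDomain_of_isRegularLocalRing (Localization.AtPrime Q'.asIdeal)
  let φ : R →+* Localization.AtPrime Q'.asIdeal :=
    (algebraMap (R ⧸ IX) _).comp (Ideal.Quotient.mk IX)
  have hkp : (RingHom.ker φ).IsPrime := RingHom.ker_isPrime φ
  have hIXφ : IX ≤ RingHom.ker φ := by
    intro a ha
    rw [RingHom.mem_ker, RingHom.comp_apply, Ideal.Quotient.eq_zero_iff_mem.2 ha, map_zero]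
  have hkle : ∀ l, P l ≤ Q → RingHom.ker φ ≤ P l := by
    intro l hl a ha
    rw [RingHom.mem_ker, RingHom.comp_apply] at ha
    obtain ⟨⟨t, ht⟩, hta⟩ := (IsLocalization.map_eq_zero_iff Q'.asIdeal.primeCompl _ _).1 ha
    obtain ⟨t, rfl⟩ := Ideal.Quotient.mk_surjective t
    have htQ : t ∉ Q := fun h => ht (Ideal.mem_map_of_mem _ h)
    rw [← map_mul, Ideal.Quotient.eq_zero_iff_mem] at hta
    exact ((hP l).1.1.mem_or_mem ((hP l).1.2 hta)).resolve_left fun h => htQ (hl h)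
  obtain ⟨l, hl⟩ := exists_le_of_iInf_le hkp (hIX.symm.le.trans hIXφ)
  have heq : ∀ l', P l' ≤ Q → l = l' := fun l' hl' =>
    hinj (le_antisymm (hl.trans (hkle l' hl'))
      ((hP l').2 (hP l).1 (hl.trans (hkle l' hl'))))
  exact (heq i hi).symm.trans (heq j hj)

/-- If `n` prime ideals have an intersection with `n` minimal primes, they are these minimal
primes. -/
lemma mem_minimalPrimes_of_injective {τ : Type*} [Finite τ] {P P' : τ → Ideal R}
    (hP : ∀ i, (P i).IsPrime) (hinj : Function.Injective P')
    (hP' : ∀ i, P' i ∈ (⨅ i, P i).minimalPrimes) :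
    Function.Injective P ∧ Set.range P' = Set.range P := by
  -- Each minimal prime contains, hence equals, one of the `P j`; having equal index sets makes this
  -- assignment a bijection.
  have h1 : ∀ i, ∃ j, P j = P' i := by
    intro i
    obtain ⟨j, hj⟩ := exists_le_of_iInf_le (hP' i).1.1 (hP' i).1.2
    exact ⟨j, le_antisymm hj ((hP' i).2 ⟨hP j, iInf_le _ j⟩ hj)⟩
  choose φ hφ using h1
  have hφi : Function.Injective φ := fun a b hab => hinj (by rw [← hφ, ← hφ, hab])
  have hφb : Function.Bijective φ := Finite.injective_iff_bijective.1 hφi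
  constructor
  · intro a b hab
    obtain ⟨a, rfl⟩ := hφb.2 a
    obtain ⟨b, rfl⟩ := hφb.2 b
    rw [hφ, hφ] at hab
    rw [hinj hab]
  · ext x
    constructor
    · rintro ⟨i, rfl⟩
      exact ⟨φ i, hφ i⟩
    · rintro ⟨j, rfl⟩
      obtain ⟨i, rfl⟩ := hφb.2 j
      exact ⟨i, (hφ i).symm⟩

end Primes

/-! ### The ideals of the theorem as monomial ideals. -/

section Setup

/-- Indices of the coordinates `x_{i,j}`, `y_j`, `w_j`. -/
abbrev CoordIndex {n : ℕ} (c : Fin n → ℕ) (r s : ℕ) : Type :=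
  (Σ i, Fin (c i)) ⊕ (Fin r ⊕ Fin s)

variable {R : Type*} [CommRing R] {n r s : ℕ} {c : Fin n → ℕ}

/-- The system of all coordinates. -/
def coords (x : (i : Fin n) → Fin (c i) → R) (y : Fin r → R) (w : Fin s → R) :
    CoordIndex c r s → R :=
  Sum.elim (fun ij : (Σ i, Fin (c i)) => x ij.1 ij.2) (Sum.elim y w)

/-- The indices of the coordinates `x_{i,j}` with given `i`. -/
def xIndices {n : ℕ} (c : Fin n → ℕ) (ρ : Type*) (i : Fin n) : Set ((Σ i, Fin (c i)) ⊕ ρ) :=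
  Set.range fun j : Fin (c i) => Sum.inl ⟨i, j⟩

/-- The indices of the coordinates `y_1, …, y_q`. -/
def yIndices {n : ℕ} (c : Fin n → ℕ) (r s q : ℕ) : Finset (CoordIndex c r s) :=
  (Finset.univ.filter fun j : Fin r => j.val < q).map
    (Function.Embedding.inl.trans Function.Embedding.inr)

/-- Exponents with a nonzero entry in `S`. -/
def nonzeroOn {ι : Type*} (S : Set ι) : Set (ι →₀ ℕ) := {α | ∃ i ∈ S, α i ≠ 0}

lemma mem_nonzeroOn {ι : Type*} {S : Set ι} {α : ι →₀ ℕ} :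
    α ∈ nonzeroOn S ↔ ∃ i ∈ S, α i ≠ 0 := Iff.rfl

lemma isUpperSet_nonzeroOn {ι : Type*} (S : Set ι) : IsUpperSet (nonzeroOn S) :=
  isUpperSet_exists_ne_zero S

lemma monIdeal_nonzeroOn {ι : Type*} (z : ι → R) (S : Set ι) :
    monIdeal z (nonzeroOn S) = Ideal.span (z '' S) := monIdeal_exists_ne_zero z S

lemma compIdeal_eq (x : (i : Fin n) → Fin (c i) → R) (y : Fin r → R) (w : Fin s → R)
    (i : Fin n) : compIdeal x i = Ideal.span (coords x y w '' xIndices c _ i) := by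
  rw [compIdeal, xIndices, ← Set.range_comp]
  rfl

lemma mem_yIndices {q : ℕ} {t : CoordIndex c r s} :
    t ∈ yIndices c r s q ↔ ∃ j : Fin r, j.val < q ∧ t = Sum.inr (Sum.inl j) := by
  simp [yIndices, eq_comm]

lemma card_yIndices {q : ℕ} (hq : q ≤ r) : (yIndices c r s q).card = q := by
  rw [yIndices, Finset.card_map, Fin.card_filter_val_lt, min_eq_right hq]

lemma mon_yIndices (x : (i : Fin n) → Fin (c i) → R) (y : Fin r → R) (w : Fin s → R) :
    mon (coords x y w) (expOf (yIndices c r s r)) = ∏ j, y j := by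
  rw [mon_expOf, yIndices, Finset.prod_map]
  simp [coords]

lemma yIndices_mono {q q' : ℕ} (h : q ≤ q') : yIndices c r s q ⊆ yIndices c r s q' := by
  intro t ht
  rw [mem_yIndices] at ht ⊢
  obtain ⟨j, hj, rfl⟩ := ht
  exact ⟨j, hj.trans_le h, rfl⟩

lemma expOf_yIndices_apply_inl (q : ℕ) (t : Σ i, Fin (c i)) :
    expOf (yIndices c r s q) (Sum.inl t) = 0 := by
  classical
  rw [expOf_apply, if_neg]
  rw [mem_yIndices]
  rintro ⟨j, -, h⟩
  cases h

variable [IsLocalRing R] [IsNoetherianRing R]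

lemma iInf_compIdeal_eq {m : ℕ} {x : (i : Fin n) → Fin (c i) → R} {y : Fin r → R} {w : Fin s → R}
    (h : IndepMod ⊥ (coords x y w))
    (hz : Ideal.span (Set.range (coords x y w)) = maximalIdeal R) (φ : Fin m → Fin n) :
    ⨅ i, compIdeal x (φ i) = monIdeal (coords x y w) (⋂ i, nonzeroOn (xIndices c _ (φ i))) := by
  rw [← h.monIdeal_iInf hz fun i => isUpperSet_nonzeroOn _]
  simp only [compIdeal_eq x y w, monIdeal_nonzeroOn]

/-- Exponents of monomials in the intersection of all components but the last one. -/
def initExponents {p : ℕ} (c : Fin (p + 1) → ℕ) (ρ : Type*) : Set (((Σ i, Fin (c i)) ⊕ ρ) →₀ ℕ) :=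
  ⋂ i : Fin p, nonzeroOn (xIndices c ρ i.castSucc)

lemma isUpperSet_initExponents {p : ℕ} (c : Fin (p + 1) → ℕ) (ρ : Type*) :
    IsUpperSet (initExponents c ρ) := isUpperSet_iInter fun _ => isUpperSet_nonzeroOn _

lemma firstIdeal_eq {p : ℕ} {c : Fin (p + 1) → ℕ} {x : (i : Fin (p + 1)) → Fin (c i) → R}
    {y : Fin r → R} {w : Fin s → R} (h : IndepMod ⊥ (coords x y w))
    (hz : Ideal.span (Set.range (coords x y w)) = maximalIdeal R) :
    firstIdeal x y = monIdeal (coords x y w)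
      (initExponents c _ ∪ Set.Ici (expOf (yIndices c r s r))) := by
  rw [firstIdeal, monIdeal_union, monIdeal_Ici, mon_yIndices, iInf_compIdeal_eq h hz]
  rfl

lemma initExponents_union_inter {p : ℕ} (c : Fin (p + 1) → ℕ) (ρ : Type*)
    (V : Set (((Σ i, Fin (c i)) ⊕ ρ) →₀ ℕ)) :
    (initExponents c ρ ∪ V) ∩ (nonzeroOn (xIndices c ρ (Fin.last p)) ∪ V) =
      ⋂ i, (nonzeroOn (xIndices c ρ i) ∪ V) := by
  ext α
  simp only [initExponents, Set.mem_inter_iff, Set.mem_union, Set.mem_iInter, Fin.forall_fin_succ']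
  by_cases hα : α ∈ V <;> simp [hα]

/-- The value of `H_{Ω,q}` computed in the regular local ring `R`. -/
lemma hilbertSamuelOmega_eq (K : Type*) [Field K] {p e q : ℕ} {c : Fin (p + 1) → ℕ}
    {x : (i : Fin (p + 1)) → Fin (c i) → R} {y : Fin r → R} {w : Fin s → R}
    (h : IndepMod ⊥ (coords x y w))
    (hz : Ideal.span (Set.range (coords x y w)) = maximalIdeal R) (he : ∑ i, c i + (r + s) = e)
    (hq : q ≤ r) (k : ℕ) :
    hilbertSamuelOmega K e c q k = colength
      (monIdeal (coords x y w) (initExponents c _ ∪ Set.Ici (expOf (yIndices c r s q))) ⊓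
        (Ideal.span (coords x y w '' xIndices c _ (Fin.last p)) ⊔
          Ideal.span {mon (coords x y w) (expOf (yIndices c r s q))}) ⊔
        maximalIdeal R ^ (k + 1)) := by
  classical
  have he' : r + s = e - ∑ i, c i := by omega
  -- The `y` and `w` variables are merged into one block with the `y` first, so that the first `q`
  -- places of the block are `y_1, …, y_q`.
  let ε : CoordIndex c r s ≃ (Σ i, Fin (c i)) ⊕ Fin (e - ∑ i, c i) :=
    Equiv.sumCongr (Equiv.refl _) (finSumFinEquiv.trans (finCongr he'))
  let Y : Finset ((Σ i, Fin (c i)) ⊕ Fin (e - ∑ i, c i)) :=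
    (Finset.univ.filter fun j : Fin (e - ∑ i, c i) => j.val < q).map Function.Embedding.inr
  have hYup : ∀ i, IsUpperSet (nonzeroOn (xIndices c (Fin (e - ∑ i, c i)) i) ∪
      Set.Ici (expOf Y)) := fun i => (isUpperSet_nonzeroOn _).union (isUpperSet_Ici _)
  have hyup : ∀ i, IsUpperSet (nonzeroOn (xIndices c (Fin r ⊕ Fin s) i) ∪
      Set.Ici (expOf (yIndices c r s q))) :=
    fun i => (isUpperSet_nonzeroOn _).union (isUpperSet_Ici _)
  have hmodel : (⨅ i : Fin (p + 1),
      Ideal.span (Set.range fun j : Fin (c i) => (MvPowerSeries.X (Sum.inl ⟨i, j⟩) :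
        MvPowerSeries ((Σ i, Fin (c i)) ⊕ Fin (e - ∑ i, c i)) K)) ⊔
      Ideal.span {∏ j : Fin (e - ∑ i, c i) with j.val < q, MvPowerSeries.X (Sum.inr j)}) =
      monIdeal MvPowerSeries.X (⋂ i, (nonzeroOn (xIndices c _ i) ∪ Set.Ici (expOf Y))) := by
    rw [← indepMod_X.monIdeal_iInf span_range_X_eq_maximalIdeal hYup]
    congr 1
    ext1 i
    rw [monIdeal_union, monIdeal_nonzeroOn, monIdeal_Ici, mon_expOf, Finset.prod_map, xIndices,
      ← Set.range_comp]
    rfl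
  rw [hilbertSamuelOmega, hilbertSamuel_eq_colength, hmodel, ← monIdeal_nonzeroOn,
    ← monIdeal_Ici, ← monIdeal_union, h.monIdeal_inf hz
      ((isUpperSet_initExponents c _).union (isUpperSet_Ici _)) (hyup _),
    initExponents_union_inter]
  refine (h.colength_congr hz indepMod_X span_range_X_eq_maximalIdeal ε
    (isUpperSet_iInter hyup) (isUpperSet_iInter hYup) (fun α => ?_) (k + 1)).symm
  simp only [Set.mem_iInter, Set.mem_union, Set.mem_Ici, mem_nonzeroOn, expOf_le_iff]
  have hY : (∀ t ∈ yIndices c r s q, α t ≠ 0) ↔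
      ∀ t ∈ Y, Finsupp.equivMapDomain ε α t ≠ 0 := by
    constructor
    · intro hα t ht
      obtain ⟨j, hj, rfl⟩ := Finset.mem_map.1 ht
      have hj : j.val < q := (Finset.mem_filter.1 hj).2
      have h1 := hα (Sum.inr (Sum.inl ⟨j, hj.trans_le hq⟩)) (mem_yIndices.2 ⟨_, hj, rfl⟩)
      have h2 : ε (Sum.inr (Sum.inl ⟨j, hj.trans_le hq⟩)) = Sum.inr j := by
        simp only [ε, Equiv.sumCongr_apply, Sum.map_inr, Equiv.trans_apply,
          finSumFinEquiv_apply_left]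
        rfl
      rw [Finsupp.equivMapDomain_apply]
      change α (ε.symm (Sum.inr j)) ≠ 0
      rwa [← h2, Equiv.symm_apply_apply]
    · intro hα t ht
      obtain ⟨j, hj, rfl⟩ := mem_yIndices.1 ht
      have h2 : ε (Sum.inr (Sum.inl j)) = Sum.inr ⟨j.val, by omega⟩ := by
        simp only [ε, Equiv.sumCongr_apply, Sum.map_inr, Equiv.trans_apply,
          finSumFinEquiv_apply_left]
        rfl
      have h1 := hα (Sum.inr ⟨j.val, by omega⟩) (Finset.mem_map.2 ⟨_, by simpa using hj, rfl⟩)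
      rwa [Finsupp.equivMapDomain_apply, ← h2, Equiv.symm_apply_apply] at h1
  rw [hY]
  refine forall_congr' fun i => or_congr_left ?_
  constructor
  · rintro ⟨_, ⟨j, rfl⟩, hj⟩
    exact ⟨_, ⟨j, rfl⟩, hj⟩
  · rintro ⟨_, ⟨j, rfl⟩, hj⟩
    exact ⟨_, ⟨j, rfl⟩, hj⟩

end Setup

/-! ### Bounds for the number of components of the divisor. -/

section Components

variable {R : Type*} [CommRing R] [IsLocalRing R] [IsNoetherianRing R]
  [Infinite (ResidueField R)] {p r s : ℕ} {c : Fin (p + 1) → ℕ}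
  {x : (i : Fin (p + 1)) → Fin (c i) → R} {y : Fin r → R} {w : Fin s → R}

/-- The number of components of `D` in a component of `X` other than the last is at most `r`. -/
lemma ncard_componentsIn_le (hz : IsRegularCoordinates (coords x y w)) {B : Ideal R} {i : Fin p}
    (hB : ∀ Q ∈ (firstIdeal x y ⊓ B).minimalPrimes, compIdeal x i.castSucc ≤ Q → ¬ B ≤ Q) :
    (componentsIn (firstIdeal x y ⊓ B) (compIdeal x i.castSucc)).ncard ≤ r := by
  classical
  have hsub : componentsIn (firstIdeal x y ⊓ B) (compIdeal x i.castSucc) ⊆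
      Set.range fun j : Fin r => compIdeal x i.castSucc ⊔ Ideal.span {y j} := by
    rintro Q ⟨hQ, hiQ⟩
    -- Such a `Q` contains `firstIdeal x y`, hence some `y_j`; the prime `I_i + (y_j)` contains the
    -- ideal of the divisor too, so `Q` equals it.
    have hF : firstIdeal x y ≤ Q := (hQ.1.1.inf_le.1 hQ.1.2).resolve_right (hB Q hQ hiQ)
    have hprod : ∏ j, y j ∈ Q :=
      hF (Ideal.mem_sup_right (Ideal.mem_span_singleton_self _))
    obtain ⟨j, -, hj⟩ := hQ.1.1.prod_mem_iff.1 hprod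
    have hprime : (compIdeal x i.castSucc ⊔ Ideal.span {y j}).IsPrime := by
      have := hz.isPrime (xIndices c _ i.castSucc ∪ {Sum.inr (Sum.inl j)})
      rwa [Set.image_union, Ideal.span_union, ← compIdeal_eq, Set.image_singleton] at this
    have hle : compIdeal x i.castSucc ⊔ Ideal.span {y j} ≤ Q :=
      sup_le hiQ ((Ideal.span_singleton_le_iff_mem _).2 hj)
    refine ⟨j, le_antisymm hle (hQ.2 ⟨hprime, inf_le_left.trans (sup_le_sup (iInf_le _ i) ?_)⟩ hle)⟩
    rw [Ideal.span_singleton_le_span_singleton]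
    exact Finset.dvd_prod_of_mem y (Finset.mem_univ j)
  refine (Set.ncard_le_ncard hsub (Set.finite_range _)).trans ?_
  rw [← Set.image_univ]
  refine (Set.ncard_image_le Set.finite_univ).trans ?_
  rw [Set.ncard_univ, Nat.card_eq_fintype_card, Fintype.card_fin]

/-- The number of components of `D` in the last component of `X` is at most the order of the
restriction of `f`. -/
lemma mem_sup_pow_of_le_ncard (hz : IsRegularCoordinates (coords x y w)) {A : Ideal R} {f : R}
    (hA : ∀ Q ∈ (A ⊓ (compIdeal x (Fin.last p) ⊔ Ideal.span {f})).minimalPrimes,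
      compIdeal x (Fin.last p) ≤ Q → ¬ A ≤ Q)
    (hdim : ∀ Q ∈ (A ⊓ (compIdeal x (Fin.last p) ⊔ Ideal.span {f})).minimalPrimes,
      compIdeal x (Fin.last p) ≤ Q →
        ringKrullDim (R ⧸ Q) + 1 = ringKrullDim (R ⧸ compIdeal x (Fin.last p))) {q : ℕ}
    (hq : q ≤ (componentsIn (A ⊓ (compIdeal x (Fin.last p) ⊔ Ideal.span {f}))
      (compIdeal x (Fin.last p))).ncard) :
    f ∈ compIdeal x (Fin.last p) ⊔ maximalIdeal R ^ q := by
  classical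
  by_contra hf
  obtain ⟨ν, hν, hν'⟩ := exists_mem_sup_pow_notMem
    (fun h => hf (Ideal.mem_sup_left h) : f ∉ compIdeal x (Fin.last p))
  have hνq : ν < q := by
    by_contra! hle
    have : compIdeal x (Fin.last p) ⊔ maximalIdeal R ^ ν ≤
        compIdeal x (Fin.last p) ⊔ maximalIdeal R ^ q :=
      sup_le_sup_left (Ideal.pow_le_pow_right hle) _
    exact hf (this hν)
  set ID := A ⊓ (compIdeal x (Fin.last p) ⊔ Ideal.span {f}) with hID
  have hfin : (componentsIn ID (compIdeal x (Fin.last p))).Finite :=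
    (Ideal.finite_minimalPrimes_of_isNoetherianRing R ID).subset fun Q hQ => hQ.1
  rw [compIdeal_eq x y w] at hν hν'
  have hcard := hz.card_components_le _ hν hν' hfin.toFinset
    (fun Q hQ => ((Set.Finite.mem_toFinset _).1 hQ).1.1.1)
    (fun Q hQ => by
      have hQ := (Set.Finite.mem_toFinset _).1 hQ
      rw [← compIdeal_eq]
      exact (hQ.1.1.1.inf_le.1 hQ.1.1.2).resolve_left (hA Q hQ.1 hQ.2))
    (fun Q hQ Q' hQ' hle => by
      have hQ := (Set.Finite.mem_toFinset _).1 hQ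
      have hQ' := (Set.Finite.mem_toFinset _).1 hQ'
      exact le_antisymm hle (hQ'.1.2 hQ.1.1 hle))
    (fun Q hQ => by
      have hQ := (Set.Finite.mem_toFinset _).1 hQ
      rw [← compIdeal_eq]
      exact hdim Q hQ.1 hQ.2)
  rw [← Set.ncard_eq_toFinset_card _ hfin] at hcard
  omega

end Components

end StableSnc

/-! ### The theorem. -/

open StableSnc in
theorem mainTheorem7 {K R : Type*} [Field K] [CharZero K] [CommRing R] [IsRegularLocalRing R]
    [Algebra K R] {p r s e q : ℕ} (hp : 1 ≤ p) (c : Fin (p + 1) → ℕ)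
    (x : (i : Fin (p + 1)) → Fin (c i) → R) (y : Fin r → R) (w : Fin s → R)
    (hcoord : IsRegularCoordinates
      (Sum.elim (fun ij : (Σ i, Fin (c i)) => x ij.1 ij.2) (Sum.elim y w)))
    (hmin : ringKrullDim R = e) (f : R) (IX ID : Ideal R)
    (hIX : IX = ⨅ i, compIdeal x i)
    (hID : ID = firstIdeal x y ⊓ (compIdeal x (Fin.last p) ⊔ Ideal.span {f}))
    (hD : IsReducedDivisor IX ID) (hsing : NoComponentInSing IX ID)
    (ha : InSigma IX ID (compIdeal x (Fin.last p)) e c q) :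
    (hilbertSamuel ID = hilbertSamuelOmega K e c q ↔
      ∃ f' : R, ID = firstIdeal x y ⊓ (compIdeal x (Fin.last p) ⊔ Ideal.span {f'}) ∧
        order f' = q ∧ orderOn (compIdeal x (Fin.last p)) f' = q ∧ r = q ∧
        f' ∈ firstIdeal x y ⊔ compIdeal x (Fin.last p)) ∧
    (hilbertSamuel ID ≠ hilbertSamuelOmega K e c q →
      ¬ hilbertSamuel ID ≤ hilbertSamuelOmega K e c q) ∧
    ((q < orderOn (compIdeal x (Fin.last p)) f ∨ q < r ∨
        f ∉ firstIdeal x y ⊔ compIdeal x (Fin.last p)) →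
      ¬ hilbertSamuel ID ≤ hilbertSamuelOmega K e c q) := by
  classical
  have hz : IsRegularCoordinates (coords x y w) := hcoord
  have hinf : Infinite (ResidueField R) := infinite_residueField K R
  have hspan := hz.span_eq
  have hind := hz.indepMod_bot
  -- the components of `X`
  obtain ⟨hmem, P, hPinj, hPrange, -, -, hleast⟩ := ha
  have hprime : ∀ i, (compIdeal x i).IsPrime := fun i => by
    rw [compIdeal_eq x y w]
    exact hz.isPrime _
  have hPmem : ∀ i, P i ∈ IX.minimalPrimes := fun i =>
    ((hPrange ▸ Set.mem_range_self i : P i ∈ {P' | P' ∈ IX.minimalPrimes ∧ _})).1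
  -- The list in `InSigma` has as many members as there are ideals `I_i`. So the `I_i` are distinct
  -- minimal primes, all of them are listed, and the lower bound `q` applies to each.
  obtain ⟨hinj, hrange⟩ := mem_minimalPrimes_of_injective hprime hPinj
    (fun i => hIX ▸ hPmem i)
  have hcomp : ∀ i, ∃ j, P j = compIdeal x i := fun i => by
    have : compIdeal x i ∈ Set.range P := hrange ▸ Set.mem_range_self i
    exact this
  have hcmin : ∀ i, compIdeal x i ∈ IX.minimalPrimes := fun i => by
    obtain ⟨j, hj⟩ := hcomp i
    exact hj ▸ hPmem j
  have hqle : ∀ i, q ≤ (componentsIn ID (compIdeal x i)).ncard := fun i => by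
    obtain ⟨j, hj⟩ := hcomp i
    rw [← hj]
    exact hleast.2 ⟨j, rfl⟩
  have huniq : ∀ Q ∈ ID.minimalPrimes, ∀ i j, compIdeal x i ≤ Q → compIdeal x j ≤ Q → i = j :=
    fun Q hQ i j hi hj => component_unique (K := K) hIX hcmin hinj hD.le hsing hQ hi hj
  let i₀ : Fin p := ⟨0, hp⟩
  have hlast : ∀ i : Fin p, i.castSucc ≠ Fin.last p := fun i => (Fin.castSucc_lt_last i).ne
  -- the numbers of components of `D`
  have hqr : q ≤ r := by
    refine (hID ▸ hqle i₀.castSucc).trans (ncard_componentsIn_le hz fun Q hQ hi hle => ?_)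
    exact hlast i₀ (huniq Q (hID ▸ hQ) _ _ hi (le_sup_left.trans hle))
  have hfq : f ∈ compIdeal x (Fin.last p) ⊔ maximalIdeal R ^ q := by
    refine mem_sup_pow_of_le_ncard hz (A := firstIdeal x y) (fun Q hQ hi hle => ?_)
      (fun Q hQ hi => hD.codim_one Q (hID ▸ hQ) _ (hcmin _) hi) (hID ▸ hqle _)
    have hQp : Q.IsPrime := hQ.1.1
    obtain ⟨i, hi'⟩ := exists_le_of_iInf_le hQp (le_sup_left.trans hle)
    exact hlast i (huniq Q (hID ▸ hQ) _ _ hi' hi)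
  -- the monomial model
  set z := coords x y w with hzdef
  set S := xIndices c (Fin r ⊕ Fin s) (Fin.last p) with hS
  set G := initExponents c (Fin r ⊕ Fin s) with hGdef
  have hG : IsUpperSet G := isUpperSet_initExponents c _
  set β := expOf (yIndices c r s q) with hβdef
  set γ := expOf (yIndices c r s r) with hγdef
  have hβγ : β ≤ γ := expOf_mono (yIndices_mono hqr)
  have hzero : ∀ q', ∀ i ∈ S, expOf (yIndices c r s q') i = 0 := by
    rintro q' _ ⟨j, rfl⟩
    exact expOf_yIndices_apply_inl q' _
  have hβdeg : β.degree = q := by rw [hβdef, degree_expOf, card_yIndices hqr]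
  have hγdeg : γ.degree = r := by rw [hγdef, degree_expOf, card_yIndices le_rfl]
  have hlastS : compIdeal x (Fin.last p) = Ideal.span (z '' S) := compIdeal_eq x y w _
  have hfirst : firstIdeal x y = monIdeal z (G ∪ Set.Ici γ) := firstIdeal_eq hind hspan
  -- If `I_m` were zero it would lie in `I_1`, against the minimality of `I_1` and the distinctness
  -- of the components.
  obtain ⟨t, ht⟩ : S.Nonempty := by
    by_contra! hempty
    have hbot : compIdeal x (Fin.last p) = ⊥ := by
      rw [hlastS, hempty, Set.image_empty, Ideal.span_empty]
    have hle : compIdeal x (Fin.last p) ≤ compIdeal x i₀.castSucc := hbot ▸ bot_le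
    exact hlast i₀ (hinj (le_antisymm ((hcmin i₀.castSucc).2 (hcmin (Fin.last p)).1 hle) hle))
  -- The monomial `x_{m,j} y_1⋯y_q` involves no variable `x_{1,j}`, so it is not in `I_1`.
  have htG : Finsupp.single t 1 + β ∉ G := by
    intro h
    obtain ⟨_, ⟨j, rfl⟩, hj⟩ := Set.mem_iInter.1 h i₀
    obtain ⟨j', rfl⟩ := ht
    rw [Finsupp.add_apply, hβdef, expOf_yIndices_apply_inl, add_zero,
      Finsupp.single_apply_ne_zero] at hj
    have := congrArg Sigma.fst (Sum.inl_injective hj.1)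
    exact hlast i₀ this
  have he : ∑ i, c i + (r + s) = e := by
    have h1 := hcoord.card_eq
    rw [hmin] at h1
    have h2 : e = Fintype.card ((Σ i, Fin (c i)) ⊕ (Fin r ⊕ Fin s)) := by exact_mod_cast h1
    simpa using h2.symm
  have hΩ : ∀ k, hilbertSamuelOmega K e c q k = (truncLength (monIdeal z (G ∪ Set.Ici β) ⊓
      (Ideal.span (z '' S) ⊔ Ideal.span {mon z β})) (k + 1) : ℕ) := fun k => by
    rw [coe_truncLength hspan]
    exact hilbertSamuelOmega_eq K hind hspan he hqr k
  have hH : ∀ k, hilbertSamuel ID k = (truncLength ID (k + 1) : ℕ) := fun k => by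
    rw [coe_truncLength hspan, hilbertSamuel_eq_colength]
  -- the strict case
  have hstrict : (q < orderOn (compIdeal x (Fin.last p)) f ∨ q < r ∨
      f ∉ firstIdeal x y ⊔ compIdeal x (Fin.last p)) →
      ¬ hilbertSamuel ID ≤ hilbertSamuelOmega K e c q := by
    intro h hle
    rw [natCast_lt_orderOn_iff, hfirst, hlastS] at h
    rw [hlastS, ← hβdeg] at hfq
    obtain ⟨k, hk⟩ := hz.exists_truncLength_model_lt hG hβγ (hzero q) (hzero r) ht htG hfq
      (by rwa [hβdeg, hγdeg])
    have h1 := hle k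
    rw [hH, hΩ, hID, hfirst, hlastS, Nat.cast_le] at h1
    omega
  -- the case of equality
  have hequal : ∀ f' : R, ID = firstIdeal x y ⊓ (compIdeal x (Fin.last p) ⊔ Ideal.span {f'}) →
      orderOn (compIdeal x (Fin.last p)) f' = q → r = q →
      f' ∈ firstIdeal x y ⊔ compIdeal x (Fin.last p) →
      hilbertSamuel ID = hilbertSamuelOmega K e c q := by
    intro f' hID' hord hrq hJ
    have hγβ : γ = β := by rw [hγdef, hβdef, hrq]
    rw [orderOn_eq_natCast_iff, hlastS, ← hβdeg] at hord
    rw [hfirst, hlastS, hγβ] at hJ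
    funext k
    rw [hH, hΩ, hID', hfirst, hlastS, hγβ, hz.truncLength_model_eq hG (hzero q) hord.1 hord.2 hJ]
  have hnot : ¬ (q < orderOn (compIdeal x (Fin.last p)) f ∨ q < r ∨
      f ∉ firstIdeal x y ⊔ compIdeal x (Fin.last p)) →
      orderOn (compIdeal x (Fin.last p)) f = q ∧ r = q ∧
        f ∈ firstIdeal x y ⊔ compIdeal x (Fin.last p) := by
    intro h
    push Not at h
    exact ⟨le_antisymm h.1 (natCast_le_orderOn hfq), le_antisymm h.2.1 hqr, h.2.2⟩
  refine ⟨⟨fun h => ?_, fun ⟨f', hID', _, hord, hrq, hJ⟩ => hequal f' hID' hord hrq hJ⟩,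
    fun hne hle => ?_, hstrict⟩
  · obtain ⟨hord, hrq, hJ⟩ := hnot fun h' => hstrict h' h.le
    -- The order of `f` in `R` may be smaller than its order on `X^{(m)}`; subtracting an element of
    -- `I_m` gives a representative in `𝔪^q`, and the ideals and the order on `X^{(m)}` stay the
    -- same.
    obtain ⟨a, ha, f', hf', hsum⟩ := Submodule.mem_sup.1 hfq
    have hff' : ∀ I : Ideal R, compIdeal x (Fin.last p) ≤ I → (f' ∈ I ↔ f ∈ I) := fun I hI => by
      rw [← hsum]
      exact ((Submodule.add_mem_iff_right I (hI ha))).symm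
    have hsup : compIdeal x (Fin.last p) ⊔ Ideal.span {f'} =
        compIdeal x (Fin.last p) ⊔ Ideal.span {f} := by
      refine le_antisymm (sup_le le_sup_left ?_) (sup_le le_sup_left ?_) <;>
        rw [Ideal.span_singleton_le_iff_mem]
      · rw [hff' _ le_sup_left]
        exact Ideal.mem_sup_right (Ideal.mem_span_singleton_self f)
      · rw [← hff' _ le_sup_left]
        exact Ideal.mem_sup_right (Ideal.mem_span_singleton_self f')
    have hord' : orderOn (compIdeal x (Fin.last p)) f' = q := by
      rw [orderOn_eq_natCast_iff] at hord ⊢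
      rwa [hff' _ le_sup_left, hff' _ le_sup_left]
    refine ⟨f', by rw [hsup, hID], ?_, hord', hrq, (hff' _ le_sup_right).2 hJ⟩
    exact le_antisymm ((orderOn_mono bot_le f').trans hord'.le)
      (natCast_le_orderOn (Ideal.mem_sup_right hf'))
  · obtain ⟨hord, hrq, hJ⟩ := hnot fun h' => hstrict h' hle
    exact hne (hequal f hID hord hrq hJ)
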